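/- Identify $\mathbb R^2$ with $\mathbb C$, $z=x+iy$. For planar vector fields $X_1,X_2$, the $2$-seasonal system is $\dot{\mathbf x}(t)=X_1(\mathbf x(t))$ for $t\in[2k,2k+1)$, $\dot{\mathbf x}(t)=X_2(\mathbf x(t))$ for $t\in[2k+1,2k+2)$, $k=0,1,2,\dots$, with $\mathbf x$ continuous. A point $p$ is locally asymptotically stable (LAS) for a system if it is Lyapunov stable and all solutions starting near $p$ exist for all later times and tend to $p$; it is a repeller if there is a ball around $p$ that every solution starting in the ball at a point other than $p$ leaves. For maps the same notions refer to orbits under iteration. (a) There exist planar polynomial vector fields $X_1,X_2$ with a common singular point that is LAS for $\dot{\mathbf x}=X_1(\mathbf x)$ and for $\dot{\mathbf x}=X_2(\mathbf x)$, but is a repeller for the $2$-seasonal system. (b) There exist planar polynomial vector fields $X_1,X_2$ with a common singular point that is a repeller for $\dot{\mathbf x}=X_1(\mathbf x)$ and for $\dot{\mathbf x}=X_2(\mathbf x)$, but is LAS for the $2$-seasonal system. (c) Explicitly, for every $\mu\in\mathbb C$ the fields $$X_1(z)=\tfrac{i\pi}{2}z-\left(1-\tfrac i2\right)\pi z^2+\left(\tfrac14-\tfrac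 i4\right)\pi z\bar z-(3-4i)\pi z^3+\left(\tfrac{3\pi}{4}-\tfrac12+i\left(\tfrac{\pi}{2}-\tfrac{11}{2}\right)\right)z^2\bar z+\tfrac{3\pi}{4}z\bar z^2+\mu\bar z^3,$$ $$X_2(z)=\tfrac{i\pi}{3}z+\left(-\tfrac12+\tfrac{i\sqrt3}{2}\right)z^2\bar z$$ satisfy (a) at the origin, and $-X_1,-X_2$ satisfy (b) at the origin. The flows $\varphi_j$ of $X_j$ satisfy $\varphi_j(1;z)=F_j(z)+O(|z|^4)$ as $z\to0$, $j=1,2$, where $$F_1(z)=iz+(1-3i)z^2+z\bar z,\qquad F_2(z)=\tfrac12(1+i\sqrt3)z-z^2\bar z,$$ and the origin is a LAS fixed point of $F_1$ and of $F_2$, but a repeller fixed point of $F_2\circ F_1$. -/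

import Mathlib

open Filter Topology

noncomputable section

namespace Seasonal

/-! The plane `ℝ²` is identified with `ℂ`, with `z = x + i y`. -/

/-- A planar vector field is polynomial if both of its real components are real polynomials in
the two real coordinates. -/
def IsPolynomialVF (X : ℂ → ℂ) : Prop :=
  ∃ P Q : MvPolynomial (Fin 2) ℝ, ∀ z : ℂ,
    (X z).re = MvPolynomial.eval ![z.re, z.im] P ∧
    (X z).im = MvPolynomial.eval ![z.re, z.im] Q

/-- `x` solves `x' = f(t, x)` on `[t₀, T]`: it is continuous there, and at every time
`t ∈ [t₀, T)` it has right derivative `f(t, x(t))`.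
When `t ↦ f(t, ·)` is constant and continuous, this says that `x` is a classical `C¹` solution.
For a right-continuous, piecewise constant `t ↦ f(t, ·)` it says that `x` is continuous and is a
classical solution on each season, with the derivative at a switching time prescribed
by the season that starts there. -/
def IsSolutionOn (f : ℝ → ℂ → ℂ) (t₀ T : ℝ) (x : ℝ → ℂ) : Prop :=
  ContinuousOn x (Set.Icc t₀ T) ∧
    ∀ t ∈ Set.Ico t₀ T, HasDerivWithinAt x (f t (x t)) (Set.Ici t) t

/-- `x` solves `x' = f(t, x)` on `[t₀, ∞)`. -/
def IsForwardSolution (f : ℝ → ℂ → ℂ) (t₀ : ℝ) (x : ℝ → ℂ) : Prop :=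
  ∀ T : ℝ, IsSolutionOn f t₀ T x

/-- The autonomous system `x' = X(x)`. -/
def autonomous (X : ℂ → ℂ) : ℝ → ℂ → ℂ := fun _ z => X z

/-- The `2`-seasonal system with unit seasons: `x' = X₁(x)` for `t ∈ [2k, 2k+1)` and
`x' = X₂(x)` for `t ∈ [2k+1, 2k+2)`. -/
def seasonal (X₁ X₂ : ℂ → ℂ) : ℝ → ℂ → ℂ :=
  fun t z => if Even ⌊t⌋ then X₁ z else X₂ z

/-- `p` is Lyapunov stable for `x' = f(t, x)`, `t ≥ 0`. -/
def IsStable (f : ℝ → ℂ → ℂ) (p : ℂ) : Prop :=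
  ∀ t₀ : ℝ, 0 ≤ t₀ → ∀ ε : ℝ, 0 < ε → ∃ δ : ℝ, 0 < δ ∧
    ∀ (T : ℝ) (x : ℝ → ℂ), IsSolutionOn f t₀ T x → dist (x t₀) p < δ →
      ∀ t ∈ Set.Icc t₀ T, dist (x t) p < ε

/-- `p` is locally attracting for `x' = f(t, x)`, `t ≥ 0`: solutions that start near `p` exist
for all later times and tend to `p`. -/
def IsLocallyAttracting (f : ℝ → ℂ → ℂ) (p : ℂ) : Prop :=
  ∀ t₀ : ℝ, 0 ≤ t₀ → ∃ η : ℝ, 0 < η ∧ ∀ z : ℂ, dist z p < η →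
    (∃ x : ℝ → ℂ, x t₀ = z ∧ IsForwardSolution f t₀ x) ∧
    ∀ x : ℝ → ℂ, x t₀ = z → IsForwardSolution f t₀ x → Tendsto x atTop (𝓝 p)

/-- `p` is locally asymptotically stable (LAS) for `x' = f(t, x)`, `t ≥ 0`. -/
def IsLAS (f : ℝ → ℂ → ℂ) (p : ℂ) : Prop :=
  IsStable f p ∧ IsLocallyAttracting f p

/-- `p` is a repeller for `x' = f(t, x)`, `t ≥ 0`: there is a ball around `p` such that every
solution that starts in it, at any time and at a point other than `p`, leaves it. The first
clause says that there is a solution that does so, the second that none stays in the ball. -/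
def IsRepeller (f : ℝ → ℂ → ℂ) (p : ℂ) : Prop :=
  ∃ r : ℝ, 0 < r ∧ ∀ t₀ : ℝ, 0 ≤ t₀ → ∀ z : ℂ, z ≠ p → dist z p < r →
    (∃ (T : ℝ) (x : ℝ → ℂ), t₀ ≤ T ∧ x t₀ = z ∧ IsSolutionOn f t₀ T x ∧ r ≤ dist (x T) p) ∧
    ∀ x : ℝ → ℂ, x t₀ = z → IsForwardSolution f t₀ x → ∃ t : ℝ, t₀ ≤ t ∧ r ≤ dist (x t) p

/-- The time-`1` map of `x' = X(x)` is defined near the origin, and there it is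
`F(z) + O(|z|^m)`. -/
def TimeOneMapEq (X F : ℂ → ℂ) (m : ℕ) : Prop :=
  ∃ C r : ℝ, 0 < r ∧ ∀ z : ℂ, ‖z‖ < r →
    (∃ x : ℝ → ℂ, x 0 = z ∧ IsSolutionOn (autonomous X) 0 1 x) ∧
    ∀ x : ℝ → ℂ, x 0 = z → IsSolutionOn (autonomous X) 0 1 x → ‖x 1 - F z‖ ≤ C * ‖z‖ ^ m

/-- `p` is a LAS fixed point of the map `F`. -/
def IsLASFixedPoint (F : ℂ → ℂ) (p : ℂ) : Prop :=
  F p = p ∧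
  (∀ ε : ℝ, 0 < ε → ∃ δ : ℝ, 0 < δ ∧ ∀ z : ℂ, dist z p < δ → ∀ n : ℕ, dist (F^[n] z) p < ε) ∧
  ∃ η : ℝ, 0 < η ∧ ∀ z : ℂ, dist z p < η → Tendsto (fun n : ℕ => F^[n] z) atTop (𝓝 p)

/-- `p` is a repeller fixed point of the map `F`: there is a ball around `p` that the orbit of
each of its points other than `p` leaves. -/
def IsRepellerFixedPoint (F : ℂ → ℂ) (p : ℂ) : Prop :=
  F p = p ∧
  ∃ r : ℝ, 0 < r ∧ ∀ z : ℂ, z ≠ p → dist z p < r → ∃ n : ℕ, r ≤ dist (F^[n] z) p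

/-- `X₁`, `X₂` are polynomial, `p` is a common singular point, LAS for each of them, and it is
a repeller for the seasonal system. -/
def ReversesLAS (X₁ X₂ : ℂ → ℂ) (p : ℂ) : Prop :=
  IsPolynomialVF X₁ ∧ IsPolynomialVF X₂ ∧ X₁ p = 0 ∧ X₂ p = 0 ∧
  IsLAS (autonomous X₁) p ∧ IsLAS (autonomous X₂) p ∧ IsRepeller (seasonal X₁ X₂) p

/-- `X₁`, `X₂` are polynomial, `p` is a common singular point, a repeller for each of them, and
it is LAS for the seasonal system. -/
def ReversesRepeller (X₁ X₂ : ℂ → ℂ) (p : ℂ) : Prop :=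
  IsPolynomialVF X₁ ∧ IsPolynomialVF X₂ ∧ X₁ p = 0 ∧ X₂ p = 0 ∧
  IsRepeller (autonomous X₁) p ∧ IsRepeller (autonomous X₂) p ∧ IsLAS (seasonal X₁ X₂) p

/-- The first vector field of the example, with its free parameter `μ`. -/
def exX₁ (μ : ℂ) (z : ℂ) : ℂ :=
  let w : ℂ := (starRingEnd ℂ) z
  let I : ℂ := Complex.I
  let π : ℂ := (Real.pi : ℂ)
  I * π / 2 * z - (1 - I / 2) * π * z ^ 2 + (1 / 4 - I / 4) * π * (z * w)
    - (3 - 4 * I) * π * z ^ 3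
    + (3 * π / 4 - 1 / 2 + I * (π / 2 - 11 / 2)) * (z ^ 2 * w)
    + 3 * π / 4 * (z * w ^ 2) + μ * w ^ 3

/-- The second vector field of the example. -/
def exX₂ (z : ℂ) : ℂ :=
  Complex.I * (Real.pi : ℂ) / 3 * z
    + (-(1 / 2) + Complex.I * (Real.sqrt 3 : ℂ) / 2) * (z ^ 2 * (starRingEnd ℂ) z)

/-- The first map of the discrete example. -/
def exF₁ (z : ℂ) : ℂ :=
  Complex.I * z + (1 - 3 * Complex.I) * z ^ 2 + z * (starRingEnd ℂ) z

/-- The second map of the discrete example. -/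
def exF₂ (z : ℂ) : ℂ :=
  1 / 2 * (1 + Complex.I * (Real.sqrt 3 : ℂ)) * z - z ^ 2 * (starRingEnd ℂ) z

end Seasonal

end

noncomputable section

namespace Seasonal

open Asymptotics

/-! Both linear parts are rotations, so stability is decided at higher order. For a map with 3-jet
`λz + bz² + cz z̄ + dz² z̄` and `|λ| = 1`, look for a Lyapunov function `V = |z|² + 2 Re(β z² z̄ + δ
z³ z̄)`. The other monomials are not needed: the jet has no `z̄²`, `z³`, `z z̄²` or `z̄³` term, so
the increment of `V` has no `z³` or `z⁴` term. Killing the coefficients of `z² z̄` and `z³ z̄` gives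
homological equations with divisors `λ - 1` and `λ² - 1`, solvable when `λ² ≠ 1`. What survives is
`κ|z|⁴ + O(|z|⁵)`, and the sign of `κ` decides (`quarticForm_isBigO`, `exists_changesBy_cubicMap`).

The number `κ` depends on the multiplier through the divisor `λ - 1`. For `F₁` the quadratic terms
give `κ = -1`; for `F₂` the cubic term gives `κ = -1`. In `F₂ ∘ F₁` the cubic term still contributes
`-1`, but the multiplier has been rotated by `π/3`, and the quadratic terms now contribute `3√3 -
4`. The total `3√3 - 5` is positive.

The fields are chosen so that their time-one maps have the 3-jets of `F₁` and `F₂`. The jet is found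
by integrating the triangular system for the Taylor coefficients of the flow, and Grönwall bounds
the error (`timeOneMapEq_cubicField`).

Sampling a solution once per period turns the increment of `V` into stability or repulsion, since
over bounded time small solutions change in norm by at most a constant factor
(`isLAS_of_sampled_decrease`, `isRepeller_of_sampled_increase`). The statements for `-X₁`, `-X₂`
follow by time reversal: the same jets then describe the inverse of the period map. -/

/-- `V` is comparable to the squared norm near the origin. -/
def IsComparable (V : ℂ → ℝ) : Prop :=
  ∃ R : ℝ, 0 < R ∧ ∀ z : ℂ, ‖z‖ < R → ‖z‖ ^ 2 / 2 ≤ V z ∧ V z ≤ 2 * ‖z‖ ^ 2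

/-- `f` has linear growth near the origin, with constants `K` on the closed ball of radius `R`. -/
def HasLinearGrowth (f : ℝ → ℂ → ℂ) (K R : ℝ) : Prop :=
  ∀ t z, ‖z‖ ≤ R → ‖f t z‖ ≤ K * ‖z‖

theorem IsSolutionOn.mono {f : ℝ → ℂ → ℂ} {a b a' b' : ℝ} {x : ℝ → ℂ}
    (h : IsSolutionOn f a b x) (ha : a ≤ a') (hb : b' ≤ b) : IsSolutionOn f a' b' x :=
  ⟨h.1.mono (Set.Icc_subset_Icc ha hb), fun t ht => h.2 t ⟨ha.trans ht.1, ht.2.trans_le hb⟩⟩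

/-! ### Growth of solutions over bounded time -/

theorem IsSolutionOn.norm_le {f : ℝ → ℂ → ℂ} {K R L t₀ T : ℝ} {x : ℝ → ℂ}
    (hf : HasLinearGrowth f K R) (hK : 0 ≤ K) (hx : IsSolutionOn f t₀ T x) (hT : T ≤ t₀ + L)
    (h0 : ‖x t₀‖ * Real.exp ((K + 1) * L) < R) :
    ∀ t ∈ Set.Icc t₀ T, ‖x t‖ ≤ Real.exp ((K + 1) * L) * ‖x t₀‖ := by
  intro t ht
  set M := Real.exp ((K + 1) * L) with hM
  have hMpos : 0 < M := Real.exp_pos _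
  -- A strictly positive comparison value `δ` is needed: the boundary comparison asks for a strict
  -- inequality `K‖x‖ < (K + 1)‖x‖`, which fails at `x = 0`. The bound follows by letting `δ`
  -- decrease to `‖x t₀‖`.
  have key : ∀ δ : ℝ, ‖x t₀‖ < δ → δ * M < R → ‖x t‖ ≤ M * δ := by
    intro δ hδ hδR
    have hδ0 : 0 < δ := (norm_nonneg _).trans_lt hδ
    have hexp : ∀ s ∈ Set.Icc t₀ T, Real.exp ((K + 1) * (s - t₀)) ≤ M := by
      intro s hs
      apply Real.exp_le_exp.2
      apply mul_le_mul_of_nonneg_left _ (by linarith)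
      linarith [hs.2]
    have hB : ∀ s, HasDerivAt (fun s => δ * Real.exp ((K + 1) * (s - t₀)))
        (δ * (Real.exp ((K + 1) * (s - t₀)) * (K + 1))) s := by
      intro s
      have h1 : HasDerivAt (fun s : ℝ => (K + 1) * (s - t₀)) (K + 1) s := by
        simpa using ((hasDerivAt_id s).sub_const t₀).const_mul (K + 1)
      exact (h1.exp).const_mul δ
    have := image_norm_le_of_norm_deriv_right_lt_deriv_boundary hx.1 hx.2
      (B := fun s => δ * Real.exp ((K + 1) * (s - t₀))) (by simpa using hδ.le) hB ?_ ht
    · refine this.trans ?_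
      rw [mul_comm M]
      exact mul_le_mul_of_nonneg_left (hexp t ht) hδ0.le
    · intro s hs heq
      have hpos : 0 < ‖x s‖ := by rw [heq]; positivity
      have hle : ‖x s‖ ≤ R := by
        rw [heq]
        exact (mul_le_mul_of_nonneg_left (hexp s ⟨hs.1, hs.2.le⟩) hδ0.le).trans hδR.le
      calc ‖f s (x s)‖ ≤ K * ‖x s‖ := hf s _ hle
        _ < (K + 1) * ‖x s‖ := by nlinarith
        _ = _ := by rw [heq]; ring
  have hcont : Tendsto (fun δ : ℝ => M * δ) (𝓝[>] ‖x t₀‖) (𝓝 (M * ‖x t₀‖)) :=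
    ((continuous_const.mul continuous_id).tendsto _).mono_left nhdsWithin_le_nhds
  refine ge_of_tendsto hcont ?_
  have h2 : ∀ᶠ δ in 𝓝[>] ‖x t₀‖, δ * M < R :=
    nhdsWithin_le_nhds
      (((continuous_id.mul continuous_const).tendsto (‖x t₀‖)).eventually (gt_mem_nhds h0))
  filter_upwards [h2, self_mem_nhdsWithin] with δ h2 h3
  exact key δ h3 h2

/-- The function `(exp(K(t - t₀))‖x‖)²` has nonnegative right derivative. Consequently a nonzero
solution cannot reach the origin in finite time. Squares avoid the non-smoothness of the norm at
zero. -/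
theorem IsSolutionOn.norm_ge {f : ℝ → ℂ → ℂ} {K R t₀ T : ℝ} {x : ℝ → ℂ}
    (hf : HasLinearGrowth f K R) (hx : IsSolutionOn f t₀ T x)
    (hR : ∀ t ∈ Set.Icc t₀ T, ‖x t‖ ≤ R) :
    ∀ t ∈ Set.Icc t₀ T, ‖x t₀‖ ≤ Real.exp (K * (t - t₀)) * ‖x t‖ := by
  intro t ht
  have h1 : ∀ s ∈ Set.Ico t₀ T, HasDerivWithinAt
      (fun s => Real.exp (K * (s - t₀)) ^ 2 * ‖x s‖ ^ 2)
      (2 * Real.exp (K * (s - t₀)) ^ 2 * K * ‖x s‖ ^ 2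
        + Real.exp (K * (s - t₀)) ^ 2 * (2 * inner ℝ (x s) (f s (x s)))) (Set.Ici s) s := by
    intro s hs
    have hB : HasDerivAt (fun s => Real.exp (K * (s - t₀)))
        (Real.exp (K * (s - t₀)) * K) s := by
      have h1 : HasDerivAt (fun s : ℝ => K * (s - t₀)) K s := by
        simpa using ((hasDerivAt_id s).sub_const t₀).const_mul K
      exact h1.exp
    have h2 := (hx.2 s hs).norm_sq
    refine ((hB.pow 2).hasDerivWithinAt.mul h2).congr_deriv ?_
    simp only [Pi.pow_apply]
    push_cast
    ring
  have h2 := image_le_of_deriv_right_le_deriv_boundary (f := fun _ => ‖x t₀‖ ^ 2)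
    (f' := fun _ => 0) (a := t₀) (b := T) continuousOn_const
    (fun s _ => hasDerivWithinAt_const _ _ _)
    (B := fun s => Real.exp (K * (s - t₀)) ^ 2 * ‖x s‖ ^ 2) (by simp)
    (by
      have := hx.1
      fun_prop) h1 ?_ ht
  · simp only [← mul_pow] at h2
    exact (sq_le_sq₀ (norm_nonneg _) (by positivity)).1 h2
  · intro s hs
    have h3 := abs_le.1 (abs_real_inner_le_norm (x s) (f s (x s)))
    have h4 := hf s (x s) (hR s ⟨hs.1, hs.2.le⟩)
    have h5 : 0 ≤ K * ‖x s‖ ^ 2 + inner ℝ (x s) (f s (x s)) := by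
      nlinarith [norm_nonneg (x s), h3.1]
    have : 0 ≤ 2 * Real.exp (K * (s - t₀)) ^ 2 *
        (K * ‖x s‖ ^ 2 + inner ℝ (x s) (f s (x s))) := by positivity
    linarith

/-! ### Orbits along which a comparable function changes at fourth order -/

/-- Since `V` does not increase, `‖y n‖²/2 ≤ V (y n) ≤ V (y 0) ≤ 2‖y 0‖²`, whence the factor 2. The
constant `M` serves only to keep the next point in the ball where `V` is comparable to the squared
norm. -/
theorem norm_le_of_step_decrease {V : ℂ → ℝ} {R ρ M c : ℝ} (hM : 1 ≤ M) (hc : 0 < c)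
    (hV : ∀ z : ℂ, ‖z‖ < R → ‖z‖ ^ 2 / 2 ≤ V z ∧ V z ≤ 2 * ‖z‖ ^ 2)
    (hρ : M * ρ ≤ R) {y : ℕ → ℂ} {N : ℕ}
    (hM' : ∀ n < N, ‖y n‖ < ρ → ‖y (n + 1)‖ ≤ M * ‖y n‖)
    (hs : ∀ n < N, ‖y n‖ < ρ → V (y (n + 1)) ≤ V (y n) - c * ‖y n‖ ^ 4)
    (h0 : 2 * ‖y 0‖ < ρ) : ∀ n ≤ N, ‖y n‖ ≤ 2 * ‖y 0‖ := by
  have hn0 := norm_nonneg (y 0)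
  have hρ0 : 0 < ρ := by linarith
  have hρR : ρ ≤ R := by nlinarith
  suffices h : ∀ n ≤ N, ‖y n‖ ≤ 2 * ‖y 0‖ ∧ V (y n) ≤ V (y 0) from fun n hn => (h n hn).1
  intro n
  induction n with
  | zero => intro _; exact ⟨by linarith, le_rfl⟩
  | succ n ih =>
    intro hn
    obtain ⟨h1, h2⟩ := ih (by omega)
    have h3 := hs n (by omega) (h1.trans_lt h0)
    have h4 := hM' n (by omega) (h1.trans_lt h0)
    have h5 : V (y (n + 1)) ≤ V (y 0) := by
      have : 0 ≤ c * ‖y n‖ ^ 4 := by positivity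
      linarith
    refine ⟨?_, h5⟩
    have h6 : ‖y (n + 1)‖ < R := by nlinarith
    have h7 := (hV _ h6).1
    have h8 := (hV (y 0) (by linarith)).2
    exact (sq_le_sq₀ (norm_nonneg _) (by positivity)).1 (by nlinarith)

/-- The decrements telescope and `V` stays nonnegative, so `∑ ‖y n‖⁴` converges. -/
theorem tendsto_zero_of_step_decrease {V : ℂ → ℝ} {R ρ M c : ℝ} (hM : 1 ≤ M) (hc : 0 < c)
    (hV : ∀ z : ℂ, ‖z‖ < R → ‖z‖ ^ 2 / 2 ≤ V z ∧ V z ≤ 2 * ‖z‖ ^ 2)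
    (hρ : M * ρ ≤ R) {y : ℕ → ℂ}
    (hM' : ∀ n, ‖y n‖ < ρ → ‖y (n + 1)‖ ≤ M * ‖y n‖)
    (hs : ∀ n, ‖y n‖ < ρ → V (y (n + 1)) ≤ V (y n) - c * ‖y n‖ ^ 4)
    (h0 : 2 * ‖y 0‖ < ρ) : Tendsto y atTop (𝓝 0) := by
  have hn0 := norm_nonneg (y 0)
  have hb : ∀ n, ‖y n‖ < ρ := fun n =>
    (norm_le_of_step_decrease hM hc hV hρ (N := n) (fun k _ => hM' k) (fun k _ => hs k) h0 n
      le_rfl).trans_lt h0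
  have hρR : ρ ≤ R := by nlinarith
  have hVn : ∀ n, 0 ≤ V (y n) := fun n =>
    le_trans (by positivity) (hV _ ((hb n).trans_le hρR)).1
  have hsum : Summable fun n => c * ‖y n‖ ^ 4 := by
    refine summable_of_sum_range_le (c := V (y 0)) (fun n => by positivity) fun n => ?_
    have : ∀ n, ∑ i ∈ Finset.range n, c * ‖y i‖ ^ 4 ≤ V (y 0) - V (y n) := by
      intro n
      induction n with
      | zero => simp
      | succ n ih =>
        rw [Finset.sum_range_succ]
        linarith [hs n (hb n)]
    linarith [this n, hVn n]
  have h1 := hsum.tendsto_atTop_zero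
  have h2 : Tendsto (fun n => ‖y n‖ ^ 4) atTop (𝓝 0) := by
    have := h1.const_mul c⁻¹
    simpa [← mul_assoc, inv_mul_cancel₀ hc.ne'] using this
  rw [tendsto_zero_iff_norm_tendsto_zero]
  have h3 := ((Real.continuous_sqrt.comp Real.continuous_sqrt).tendsto 0).comp h2
  simp only [Function.comp, Real.sqrt_zero] at h3
  refine h3.congr fun n => ?_
  simp only [Function.comp]
  rw [show ‖y n‖ ^ 4 = (‖y n‖ ^ 2) ^ 2 by ring, Real.sqrt_sq (by positivity),
    Real.sqrt_sq (by positivity)]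

theorem exists_le_norm_of_step_increase {V : ℂ → ℝ} {R ρ c : ℝ} (hc : 0 < c)
    (hV : ∀ z : ℂ, ‖z‖ < R → ‖z‖ ^ 2 / 2 ≤ V z ∧ V z ≤ 2 * ‖z‖ ^ 2)
    (hρ : ρ ≤ R) {y : ℕ → ℂ}
    (hs : ∀ n, ‖y n‖ < ρ → V (y n) + c * ‖y n‖ ^ 4 ≤ V (y (n + 1)))
    (h0 : y 0 ≠ 0) : ∃ n, ρ ≤ ‖y n‖ := by
  by_contra! hb
  have hV0 : 0 < V (y 0) := by
    have := norm_pos_iff.2 h0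
    exact lt_of_lt_of_le (by positivity) (hV _ ((hb 0).trans_le hρ)).1
  -- As `V` does not drop below `V (y 0)`, one has `‖y n‖² ≥ V (y 0)/2`; hence each step gains at
  -- least the fixed amount `d`, which is impossible for ever in a bounded set.
  set d := c * (V (y 0) / 2) ^ 2 with hd
  have hd0 : 0 < d := by positivity
  have hinc : ∀ n : ℕ, V (y 0) + n * d ≤ V (y n) := by
    intro n
    induction n with
    | zero => simp
    | succ n ih =>
      have h1 := hs n (hb n)
      have h2 := (hV _ ((hb n).trans_le hρ)).2
      have h3 : V (y 0) ≤ V (y n) := by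
        have : 0 ≤ n * d := by positivity
        linarith
      have h4 : d ≤ c * ‖y n‖ ^ 4 := by
        rw [hd, show ‖y n‖ ^ 4 = (‖y n‖ ^ 2) ^ 2 by ring]
        gcongr
        linarith
      push_cast
      linarith
  obtain ⟨n, hn⟩ := exists_nat_gt (2 * ρ ^ 2 / d)
  have h1 := hinc n
  have h2 := (hV _ ((hb n).trans_le hρ)).2
  have h3 : 2 * ρ ^ 2 < n * d := by rwa [div_lt_iff₀ hd0] at hn
  have h4 : ‖y n‖ ^ 2 ≤ ρ ^ 2 := by
    have := hb n
    gcongr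
  linarith

/-! ### Maps -/

theorem isLASFixedPoint_of_step_decrease {F : ℂ → ℂ} (hF : F 0 = 0) {V : ℂ → ℝ}
    (hV : IsComparable V) {ρ M c : ℝ} (hρ : 0 < ρ) (hc : 0 < c)
    (hM : ∀ z, ‖z‖ < ρ → ‖F z‖ ≤ M * ‖z‖)
    (hs : ∀ z, ‖z‖ < ρ → V (F z) ≤ V z - c * ‖z‖ ^ 4) : IsLASFixedPoint F 0 := by
  obtain ⟨R, hR, hV⟩ := hV
  set M' := max M 1
  have hM1 : 1 ≤ M' := le_max_right _ _
  have hM' : ∀ z, ‖z‖ < ρ → ‖F z‖ ≤ M' * ‖z‖ := fun z hz =>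
    (hM z hz).trans (mul_le_mul_of_nonneg_right (le_max_left _ _) (norm_nonneg _))
  set σ := min ρ (R / M')
  have hσ : 0 < σ := lt_min hρ (by positivity)
  have hσρ : σ ≤ ρ := min_le_left _ _
  have hσR : M' * σ ≤ R := by
    have : σ ≤ R / M' := min_le_right _ _
    rw [le_div_iff₀ (by positivity)] at this
    linarith
  refine ⟨hF, ?_, σ / 2, by positivity, ?_⟩
  · intro ε hε
    refine ⟨min (σ / 2) (ε / 2), by positivity, fun z hz n => ?_⟩
    rw [dist_zero_right] at hz ⊢
    have h1 := hz.trans_le (min_le_left _ _)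
    have h2 := hz.trans_le (min_le_right _ _)
    have := norm_le_of_step_decrease hM1 hc hV hσR (y := fun n => F^[n] z) (N := n)
      (fun k _ hk => by
        simp only [Function.iterate_succ_apply'] at hk ⊢
        exact hM' _ (hk.trans_le hσρ))
      (fun k _ hk => by
        simp only [Function.iterate_succ_apply'] at hk ⊢
        exact hs _ (hk.trans_le hσρ)) (by simp; linarith) n le_rfl
    simp only [Function.iterate_zero, id] at this
    linarith
  · intro z hz
    rw [dist_zero_right] at hz
    exact tendsto_zero_of_step_decrease hM1 hc hV hσR (y := fun n => F^[n] z)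
      (fun k hk => by
        simp only [Function.iterate_succ_apply'] at hk ⊢
        exact hM' _ (hk.trans_le hσρ))
      (fun k hk => by
        simp only [Function.iterate_succ_apply'] at hk ⊢
        exact hs _ (hk.trans_le hσρ)) (by simp; linarith)

theorem isRepellerFixedPoint_of_step_increase {F : ℂ → ℂ} (hF : F 0 = 0) {V : ℂ → ℝ}
    (hV : IsComparable V) {ρ c : ℝ} (hρ : 0 < ρ) (hc : 0 < c)
    (hs : ∀ z, ‖z‖ < ρ → V z + c * ‖z‖ ^ 4 ≤ V (F z)) : IsRepellerFixedPoint F 0 := by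
  obtain ⟨R, hR, hV⟩ := hV
  refine ⟨hF, min ρ R, lt_min hρ hR, fun z hz _ => ?_⟩
  obtain ⟨n, hn⟩ := exists_le_norm_of_step_increase hc hV (min_le_right ρ R)
    (y := fun n => F^[n] z) (fun k hk => by
        simp only [Function.iterate_succ_apply'] at hk ⊢
        exact hs _ (hk.trans_le (min_le_left _ _))) (by simpa using hz)
  exact ⟨n, by simpa using hn⟩

/-! ### Differential equations -/

/-- `f` agrees, on any ball around the origin, with a system whose forward solutions are global. -/
def HasGlobalCutoffs (f : ℝ → ℂ → ℂ) : Prop :=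
  ∀ R : ℝ, ∃ g : ℝ → ℂ → ℂ, (∀ t z, ‖z‖ ≤ R → g t z = f t z) ∧
    ∀ t₀ : ℝ, 0 ≤ t₀ → ∀ z, ∃ x : ℝ → ℂ, x t₀ = z ∧ IsForwardSolution g t₀ x

theorem IsSolutionOn.of_eqOn_ball {f g : ℝ → ℂ → ℂ} {R t₀ T : ℝ} {x : ℝ → ℂ}
    (hg : ∀ t z, ‖z‖ ≤ R → g t z = f t z) (hx : IsSolutionOn g t₀ T x)
    (hR : ∀ t ∈ Set.Icc t₀ T, ‖x t‖ ≤ R) : IsSolutionOn f t₀ T x :=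
  ⟨hx.1, fun t ht => by
    rw [← hg t _ (hR t ⟨ht.1, ht.2.le⟩)]
    exact hx.2 t ht⟩

/-- From a point of the open ball there starts either a solution that stays in it for ever, or
one that reaches the bounding circle. -/
theorem HasGlobalCutoffs.exists_solution {f : ℝ → ℂ → ℂ} (hf : HasGlobalCutoffs f) {R t₀ : ℝ}
    (ht₀ : 0 ≤ t₀) {z : ℂ} (hz : ‖z‖ < R) :
    ∃ x : ℝ → ℂ, x t₀ = z ∧
      ((IsForwardSolution f t₀ x ∧ ∀ t, t₀ ≤ t → ‖x t‖ < R) ∨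
        ∃ T, t₀ ≤ T ∧ IsSolutionOn f t₀ T x ∧ (∀ t ∈ Set.Icc t₀ T, ‖x t‖ ≤ R) ∧ ‖x T‖ = R) := by
  obtain ⟨g, hg, hex⟩ := hf R
  obtain ⟨x, hx0, hx⟩ := hex t₀ ht₀ z
  refine ⟨x, hx0, ?_⟩
  by_cases h : ∀ t, t₀ ≤ t → ‖x t‖ < R
  · refine Or.inl ⟨fun T => (hx T).of_eqOn_ball hg fun t ht => (h t ht.1).le, h⟩
  · right
    push Not at h
    obtain ⟨t₁, ht₁, hR⟩ := h
    have hcont : ContinuousOn (fun t => ‖x t‖) (Set.Icc t₀ t₁) := (hx t₁).1.norm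
    -- The infimum of `S` is the first time at which the circle is reached; up to then the cut-off
    -- system and `f` agree along the solution.
    set S := Set.Icc t₀ t₁ ∩ (fun t => ‖x t‖) ⁻¹' Set.Ici R with hS
    have hSc : IsCompact S := by
      have : IsClosed S := hcont.preimage_isClosed_of_isClosed isClosed_Icc isClosed_Ici
      exact isCompact_Icc.of_isClosed_subset this Set.inter_subset_left
    have hSne : S.Nonempty := ⟨t₁, ⟨ht₁, le_rfl⟩, hR⟩
    have hT := hSc.sInf_mem hSne
    set T := sInf S
    have hlt : ∀ t, t₀ ≤ t → t < T → ‖x t‖ < R := by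
      intro t ht htT
      by_contra! hcon
      exact absurd (csInf_le hSc.bddBelow ⟨⟨ht, htT.le.trans hT.1.2⟩, hcon⟩) (not_le.2 htT)
    have hT0 : t₀ < T := by
      refine lt_of_le_of_ne hT.1.1 fun h => ?_
      have := hT.2
      simp only [Set.mem_preimage, Set.mem_Ici, ← h, hx0] at this
      linarith
    have hTle : ‖x T‖ ≤ R := by
      have h1 : ContinuousWithinAt (fun t => ‖x t‖) (Set.Ico t₀ T) T :=
        (hcont T hT.1).mono fun s hs => ⟨hs.1, hs.2.le.trans hT.1.2⟩
      have : (𝓝[Set.Ico t₀ T] T).NeBot := by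
        rw [← mem_closure_iff_nhdsWithin_neBot, closure_Ico hT0.ne]
        exact ⟨hT0.le, le_rfl⟩
      exact le_of_tendsto h1 (eventually_nhdsWithin_of_forall fun s hs => (hlt s hs.1 hs.2).le)
    have hall : ∀ t ∈ Set.Icc t₀ T, ‖x t‖ ≤ R := by
      intro t ht
      rcases ht.2.lt_or_eq with h | h
      · exact (hlt t ht.1 h).le
      · rwa [h]
    exact ⟨T, hT0.le, (hx T).of_eqOn_ball hg hall, hall, le_antisymm hTle hT.2⟩

/-! ### Solutions sampled at the times `a + p n` -/

section Sampling

variable {f : ℝ → ℂ → ℂ} {a p : ℝ}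

theorem exists_sampling_time (ha : 0 ≤ a) (hp : 0 < p) {t₀ : ℝ} (ht₀ : 0 ≤ t₀) :
    ∃ k : ℕ, t₀ ≤ a + p * k ∧ a + p * k ≤ t₀ + (a + p) := by
  refine ⟨⌈t₀ / p⌉₊, ?_, ?_⟩
  · have := Nat.le_ceil (t₀ / p)
    rw [div_le_iff₀ hp] at this
    linarith
  · have := Nat.ceil_lt_add_one (show 0 ≤ t₀ / p by positivity)
    have h2 : p * ⌈t₀ / p⌉₊ ≤ p * (t₀ / p + 1) := mul_le_mul_of_nonneg_left this.le hp.le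
    have h3 : p * (t₀ / p + 1) = t₀ + p := by field_simp
    linarith

/-- Solutions that start near the origin stay near, and those that exist for ever come
arbitrarily close to it at the sampling times, when `V` decreases between sampling times. -/
theorem sampled_decrease_bounds {K R₀ : ℝ} (hf : HasLinearGrowth f K R₀) (hK : 0 ≤ K)
    (hR₀ : 0 < R₀) (ha : 0 ≤ a) (hp : 0 < p) {V : ℂ → ℝ} (hV : IsComparable V) {ρ c : ℝ}
    (hρ : 0 < ρ) (hc : 0 < c)
    (hs : ∀ (n : ℕ) (x : ℝ → ℂ), IsSolutionOn f (a + p * n) (a + p * n + p) x →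
      ‖x (a + p * n)‖ < ρ → V (x (a + p * n + p)) ≤ V (x (a + p * n)) - c * ‖x (a + p * n)‖ ^ 4) :
    ∃ C δ : ℝ, 1 ≤ C ∧ 0 < δ ∧ (∀ (t₀ T : ℝ) (x : ℝ → ℂ), 0 ≤ t₀ → IsSolutionOn f t₀ T x →
      ‖x t₀‖ < δ → ∀ t ∈ Set.Icc t₀ T, ‖x t‖ ≤ C * ‖x t₀‖) ∧
      ∀ (t₀ : ℝ) (x : ℝ → ℂ), 0 ≤ t₀ → IsForwardSolution f t₀ x → ‖x t₀‖ < δ →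
        ∀ ε, 0 < ε → ∃ τ, t₀ ≤ τ ∧ ‖x τ‖ < ε := by
  obtain ⟨R, hR, hV⟩ := hV
  set M := Real.exp ((K + 1) * (a + p)) with hMdef
  have hM : 1 ≤ M := Real.one_le_exp (by positivity)
  have hM0 : 0 < M := by linarith
  set σ := min ρ (min (R / M) (R₀ / M)) with hσdef
  have hσ : 0 < σ := by positivity
  have hσρ : σ ≤ ρ := min_le_left _ _
  have hσR : M * σ ≤ R := by
    have : σ ≤ R / M := (min_le_right _ _).trans (min_le_left _ _)
    rw [le_div_iff₀ hM0] at this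
    linarith
  have hσR₀ : M * σ ≤ R₀ := by
    have : σ ≤ R₀ / M := (min_le_right _ _).trans (min_le_right _ _)
    rw [le_div_iff₀ hM0] at this
    linarith
  have grow : ∀ (t₀ T : ℝ) (x : ℝ → ℂ), IsSolutionOn f t₀ T x → T ≤ t₀ + (a + p) → ‖x t₀‖ < σ →
      ∀ t ∈ Set.Icc t₀ T, ‖x t‖ ≤ M * ‖x t₀‖ := fun t₀ T x hx hT h0 =>
    hx.norm_le hf hK hT (by rw [← hMdef]; nlinarith)
  have hk : ∀ k n : ℕ, a + p * (k + (n + 1 : ℕ)) = a + p * ((k + n : ℕ) : ℝ) + p := by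
    intro k n; push_cast; ring
  have hk' : ∀ k n : ℕ, a + p * ((k : ℝ) + n) = a + p * ((k + n : ℕ) : ℝ) := by
    intro k n; push_cast; ring
  have step1 : ∀ (k : ℕ) (x : ℝ → ℂ) (n : ℕ), IsSolutionOn f (a + p * k)
      (a + p * (k + (n + 1 : ℕ))) x → ‖x (a + p * (k + n))‖ < σ →
      ‖x (a + p * (k + (n + 1 : ℕ)))‖ ≤ M * ‖x (a + p * (k + n))‖ := by
    intro k x n hx hn
    have hle : a + p * k ≤ a + p * ((k : ℝ) + n) := by
      have : 0 ≤ p * n := by positivity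
      linarith
    have h1 := hx.mono hle le_rfl
    refine grow _ _ x h1 ?_ hn _ ⟨?_, le_rfl⟩
    · push_cast; linarith
    · push_cast; linarith
  have step2 : ∀ (k : ℕ) (x : ℝ → ℂ) (n : ℕ), IsSolutionOn f (a + p * k)
      (a + p * (k + (n + 1 : ℕ))) x → ‖x (a + p * (k + n))‖ < σ →
      V (x (a + p * (k + (n + 1 : ℕ)))) ≤
        V (x (a + p * (k + n))) - c * ‖x (a + p * (k + n))‖ ^ 4 := by
    intro k x n hx hn
    have hle : a + p * k ≤ a + p * ((k : ℝ) + n) := by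
      have : 0 ≤ p * n := by positivity
      linarith
    have h1 := hx.mono hle le_rfl
    rw [hk] at h1 ⊢
    rw [hk'] at h1 hn ⊢
    exact hs _ x h1 (hn.trans_le hσρ)
  -- One factor `M` is growth up to the first sampling time, the factor 2 comes from
  -- `norm_le_of_step_decrease`, and the other `M` is growth after the last sampling time before
  -- `t`. None of the constants depends on `t₀`.
  refine ⟨2 * M * M, σ / (2 * M), by nlinarith, by positivity, ?_, ?_⟩
  · intro t₀ T x ht₀ hx h0 t ht
    rw [lt_div_iff₀ (by positivity)] at h0
    have hn := norm_nonneg (x t₀)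
    have hMn : ‖x t₀‖ ≤ M * ‖x t₀‖ := by nlinarith
    obtain ⟨k, hk1, hk2⟩ := exists_sampling_time ha hp ht₀
    rcases le_total t (a + p * k) with h | h
    · have := grow t₀ t x (hx.mono le_rfl ht.2) (by linarith) (by linarith) t ⟨ht.1, le_rfl⟩
      nlinarith
    · have h1 := grow t₀ (a + p * k) x (hx.mono le_rfl (h.trans ht.2)) (by linarith)
        (by linarith) _ ⟨hk1, le_rfl⟩
      set n := ⌊(t - (a + p * k)) / p⌋₊ with hndef
      have hn1 : p * n ≤ t - (a + p * k) := by
        have := Nat.floor_le (show 0 ≤ (t - (a + p * k)) / p from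
          div_nonneg (by linarith) hp.le)
        rw [le_div_iff₀ hp] at this
        linarith
      have hn2 : t - (a + p * k) < p * (n + 1) := by
        have := Nat.lt_floor_add_one ((t - (a + p * k)) / p)
        rw [div_lt_iff₀ hp] at this
        linarith
      have hxk : ∀ j < n, IsSolutionOn f (a + p * k) (a + p * (k + (j + 1 : ℕ))) x := by
        intro j hj
        refine hx.mono hk1 ?_
        have : ((j + 1 : ℕ) : ℝ) ≤ n := by exact_mod_cast hj
        have := mul_le_mul_of_nonneg_left this hp.le
        rw [mul_add]
        linarith [ht.2]
      have h2 := norm_le_of_step_decrease hM hc hV hσR (N := n)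
        (y := fun j => x (a + p * (k + j))) (fun j hj => step1 k x j (hxk j hj))
        (fun j hj => step2 k x j (hxk j hj)) (by simp; nlinarith) n le_rfl
      simp only [Nat.cast_zero, add_zero] at h2
      have h3 := grow (a + p * (k + n)) t x (hx.mono (by nlinarith) ht.2) (by nlinarith)
        (by nlinarith) t ⟨by linarith, le_rfl⟩
      calc ‖x t‖ ≤ M * ‖x (a + p * (k + n))‖ := h3
        _ ≤ M * (2 * (M * ‖x t₀‖)) := by gcongr; linarith
        _ = _ := by ring
  · intro t₀ x ht₀ hx h0 ε hε
    rw [lt_div_iff₀ (by positivity)] at h0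
    have hn := norm_nonneg (x t₀)
    obtain ⟨k, hk1, hk2⟩ := exists_sampling_time ha hp ht₀
    have h1 := grow t₀ (a + p * k) x (hx _) (by linarith)
        (by nlinarith) _ ⟨hk1, le_rfl⟩
    have hxk : ∀ j : ℕ, IsSolutionOn f (a + p * k) (a + p * (k + (j + 1 : ℕ))) x :=
      fun j => (hx _).mono hk1 le_rfl
    have h2 := tendsto_zero_of_step_decrease hM hc hV hσR
        (y := fun j : ℕ => x (a + p * (k + j))) (fun j => step1 k x j (hxk j))
        (fun j => step2 k x j (hxk j)) (by simp; nlinarith)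
    obtain ⟨n, hn⟩ := (h2.eventually (Metric.ball_mem_nhds 0 hε)).exists
    refine ⟨_, ?_, by simpa using hn⟩
    have : 0 ≤ p * n := by positivity
    linarith

theorem isLAS_of_sampled_decrease {K R₀ : ℝ} (hf : HasLinearGrowth f K R₀) (hK : 0 ≤ K)
    (hR₀ : 0 < R₀) (hcut : HasGlobalCutoffs f) (ha : 0 ≤ a) (hp : 0 < p) {V : ℂ → ℝ}
    (hV : IsComparable V) {ρ c : ℝ} (hρ : 0 < ρ) (hc : 0 < c)
    (hs : ∀ (n : ℕ) (x : ℝ → ℂ), IsSolutionOn f (a + p * n) (a + p * n + p) x →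
      ‖x (a + p * n)‖ < ρ → V (x (a + p * n + p)) ≤ V (x (a + p * n)) - c * ‖x (a + p * n)‖ ^ 4) :
    IsLAS f 0 := by
  obtain ⟨C, δ, hC, hδ, hstab, hatt⟩ := sampled_decrease_bounds hf hK hR₀ ha hp hV hρ hc hs
  have hC0 : 0 < C := by linarith
  constructor
  · intro t₀ ht₀ ε hε
    refine ⟨min δ (ε / C), by positivity, fun T x hx h0 t ht => ?_⟩
    rw [dist_zero_right] at h0 ⊢
    have h1 := hstab t₀ T x ht₀ hx (h0.trans_le (min_le_left _ _)) t ht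
    have h2 := h0.trans_le (min_le_right _ _)
    rw [lt_div_iff₀ hC0] at h2
    linarith
  · intro t₀ ht₀
    refine ⟨δ, hδ, fun z hz => ⟨?_, ?_⟩⟩
    · rw [dist_zero_right] at hz
      -- Reaching the circle of radius `C * δ` would contradict the bound `‖x T‖ ≤ C‖z‖ < C * δ`, so
      -- the solution is global.
      obtain ⟨x, hx0, hx | ⟨T, hT, hx, _, hxT⟩⟩ :=
        hcut.exists_solution (R := C * δ) ht₀ (z := z) (by nlinarith)
      · exact ⟨x, hx0, hx.1⟩
      · have := hstab t₀ T x ht₀ hx (by rwa [hx0]) T ⟨hT, le_rfl⟩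
        rw [hx0, hxT] at this
        nlinarith
    · intro x hx0 hx
      rw [dist_zero_right, ← hx0] at hz
      rw [Metric.tendsto_atTop]
      intro ε hε
      -- It suffices to be small at one time `τ`: the stability bound, uniform in the initial time,
      -- then applies from `τ` on.
      obtain ⟨τ, hτ, hxτ⟩ := hatt t₀ x ht₀ hx hz (min δ (ε / C)) (by positivity)
      refine ⟨τ, fun t ht => ?_⟩
      rw [dist_zero_right]
      have h1 := hstab τ t x (ht₀.trans hτ) ((hx t).mono hτ le_rfl)
        (hxτ.trans_le (min_le_left _ _)) t ⟨ht, le_rfl⟩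
      have h2 := hxτ.trans_le (min_le_right _ _)
      rw [lt_div_iff₀ hC0] at h2
      linarith

theorem isRepeller_of_sampled_increase {K R₀ : ℝ} (hf : HasLinearGrowth f K R₀)
    (hR₀ : 0 < R₀) (hcut : HasGlobalCutoffs f) (ha : 0 ≤ a) (hp : 0 < p) {V : ℂ → ℝ}
    (hV : IsComparable V) {ρ c : ℝ} (hρ : 0 < ρ) (hc : 0 < c)
    (hs : ∀ (n : ℕ) (x : ℝ → ℂ), IsSolutionOn f (a + p * n) (a + p * n + p) x →
      ‖x (a + p * n)‖ < ρ → V (x (a + p * n)) + c * ‖x (a + p * n)‖ ^ 4 ≤ V (x (a + p * n + p))) :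
    IsRepeller f 0 := by
  obtain ⟨R, hR, hV⟩ := hV
  set σ := min ρ (min R R₀)
  have hσ : 0 < σ := by positivity
  have hσρ : σ ≤ ρ := min_le_left _ _
  have hσR : σ ≤ R := (min_le_right _ _).trans (min_le_left _ _)
  have hσR₀ : σ ≤ R₀ := (min_le_right _ _).trans (min_le_right _ _)
  have leaves : ∀ (t₀ : ℝ) (x : ℝ → ℂ), 0 ≤ t₀ → x t₀ ≠ 0 → IsForwardSolution f t₀ x →
      ∃ t, t₀ ≤ t ∧ σ ≤ ‖x t‖ := by
    intro t₀ x ht₀ hx0 hx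
    by_contra! hcon
    obtain ⟨k, hk1, -⟩ := exists_sampling_time ha hp ht₀
    have hne : x (a + p * k) ≠ 0 := by
      intro h
      have := (hx (a + p * k)).norm_ge hf (fun t ht => (hcon t ht.1).le.trans hσR₀) _
        ⟨hk1, le_rfl⟩
      rw [h, norm_zero, mul_zero] at this
      exact hx0 (norm_le_zero_iff.1 this)
    have hle : ∀ n : ℕ, t₀ ≤ a + p * ((k + n : ℕ) : ℝ) := fun n => by
      have : 0 ≤ p * n := by positivity
      push_cast
      linarith
    obtain ⟨n, hn⟩ := exists_le_norm_of_step_increase hc hV hσR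
      (y := fun n => x (a + p * ((k + n : ℕ) : ℝ))) (fun n hn => by
        have h1 : a + p * ((k + (n + 1) : ℕ) : ℝ) = a + p * ((k + n : ℕ) : ℝ) + p := by
          push_cast; ring
        simp only [h1] at hn ⊢
        exact hs (k + n) x ((hx _).mono (hle n) le_rfl) (hn.trans_le hσρ)) (by simpa using hne)
    exact absurd hn (not_le.2 (hcon _ (hle n)))
  refine ⟨σ, hσ, fun t₀ ht₀ z hz hzσ => ⟨?_, ?_⟩⟩
  · rw [dist_zero_right] at hzσ
    obtain ⟨x, hx0, hx | ⟨T, hT, hx, _, hxT⟩⟩ := hcut.exists_solution ht₀ hzσ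
    · obtain ⟨t, ht, htσ⟩ := leaves t₀ x ht₀ (by rwa [hx0]) hx.1
      exact absurd htσ (not_le.2 (hx.2 t ht))
    · exact ⟨T, x, hT, hx0, hx, by rw [dist_zero_right, hxT]⟩
  · intro x hx0 hx
    obtain ⟨t, ht, htσ⟩ := leaves t₀ x ht₀ (by rwa [hx0]) hx
    exact ⟨t, ht, by rwa [dist_zero_right]⟩

end Sampling

/-! ### Existence of solutions -/

theorem IsSolutionOn.congr {f : ℝ → ℂ → ℂ} {a b : ℝ} {x y : ℝ → ℂ} (hx : IsSolutionOn f a b x)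
    (h : ∀ t ∈ Set.Icc a b, y t = x t) : IsSolutionOn f a b y := by
  refine ⟨hx.1.congr h, fun t ht => ?_⟩
  have ht' : t ∈ Set.Icc a b := ⟨ht.1, ht.2.le⟩
  rw [h t ht']
  refine (hx.2 t ht).congr_of_eventuallyEq ?_ (h t ht')
  filter_upwards [Ico_mem_nhdsGE ht.2] with s hs
  exact h s ⟨ht.1.trans hs.1, hs.2.le⟩

theorem IsSolutionOn.congr_field {f g : ℝ → ℂ → ℂ} {a b : ℝ} {x : ℝ → ℂ}
    (hx : IsSolutionOn f a b x) (h : ∀ t ∈ Set.Ico a b, g t = f t) : IsSolutionOn g a b x :=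
  ⟨hx.1, fun t ht => by rw [h t ht]; exact hx.2 t ht⟩

theorem IsSolutionOn.concat {f : ℝ → ℂ → ℂ} {a b c : ℝ} {x : ℝ → ℂ} (hab : a ≤ b) (hbc : b ≤ c)
    (h₁ : IsSolutionOn f a b x) (h₂ : IsSolutionOn f b c x) : IsSolutionOn f a c x := by
  refine ⟨?_, fun t ht => ?_⟩
  · rw [← Set.Icc_union_Icc_eq_Icc hab hbc]
    exact h₁.1.union_of_isClosed h₂.1 isClosed_Icc isClosed_Icc
  · rcases lt_or_ge t b with h | h
    · exact h₁.2 t ⟨ht.1, h⟩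
    · exact h₂.2 t ⟨h, ht.2⟩

theorem exists_isForwardSolution_of_pieces {f : ℝ → ℂ → ℂ} {τ : ℕ → ℝ} (hτ : StrictMono τ)
    (hτ' : Tendsto τ atTop atTop)
    (h : ∀ n v, ∃ x : ℝ → ℂ, x (τ n) = v ∧ IsSolutionOn f (τ n) (τ (n + 1)) x) (z : ℂ) :
    ∃ x : ℝ → ℂ, x (τ 0) = z ∧ IsForwardSolution f (τ 0) x := by
  classical
  choose S hS0 hS using h
  -- `v n` is the state at time `τ n`: the end of each piece is the initial value of the next.
  let v : ℕ → ℂ := fun n => Nat.rec z (fun n w => S n w (τ (n + 1))) n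
  have hv : ∀ n, v (n + 1) = S n (v n) (τ (n + 1)) := fun n => rfl
  have hex : ∀ t, ∃ n, t < τ (n + 1) := fun t =>
    (((tendsto_add_atTop_iff_nat 1).2 hτ').eventually_gt_atTop t).exists
  let N : ℝ → ℕ := fun t => Nat.find (hex t)
  have hN : ∀ n t, τ n ≤ t → t < τ (n + 1) → N t = n := by
    intro n t h1 h2
    refine (Nat.find_eq_iff (hex t)).2 ⟨h2, fun m hm => not_lt.2 ?_⟩
    exact (hτ.monotone hm).trans h1
  let x : ℝ → ℂ := fun t => S (N t) (v (N t)) t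
  have hxτ : ∀ n, x (τ n) = v n := by
    intro n
    simp only [x, hN n (τ n) le_rfl (hτ n.lt_succ_self), hS0]
  have hpiece : ∀ n, IsSolutionOn f (τ n) (τ (n + 1)) x := by
    intro n
    refine (hS n (v n)).congr fun t ht => ?_
    rcases ht.2.lt_or_eq with h | h
    · simp only [x, hN n t ht.1 h]
    · rw [h, hxτ, hv]
  have hall : ∀ n, IsSolutionOn f (τ 0) (τ (n + 1)) x := by
    intro n
    induction n with
    | zero => exact hpiece 0
    | succ n ih =>
      exact ih.concat (hτ.monotone (Nat.zero_le _)) (hτ (n + 1).lt_succ_self).le (hpiece (n + 1))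
  refine ⟨x, hxτ 0, fun T => ?_⟩
  obtain ⟨n, hn⟩ := hex T
  exact (hall n).mono le_rfl hn.le

theorem exists_isSolutionOn_autonomous {g : ℂ → ℂ} {K B : NNReal} (hg : LipschitzWith K g)
    (hB : ∀ z, ‖g z‖ ≤ B) {a b : ℝ} (hab : a ≤ b) (v : ℂ) :
    ∃ x : ℝ → ℂ, x a = v ∧ IsSolutionOn (autonomous g) a b x := by
  -- Because `g` is globally bounded and Lipschitz, the ball of radius `B (b - a)` is large enough
  -- to make Picard-Lindelöf work on the whole interval at once.
  have hPL : IsPicardLindelof (fun _ : ℝ => g) (⟨a, ⟨le_rfl, hab⟩⟩ : Set.Icc a b) v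
      (B * (b - a).toNNReal) 0 B K :=
    { lipschitzOnWith := fun _ _ => hg.lipschitzOnWith
      continuousOn := fun _ _ => continuousOn_const
      norm_le := fun _ _ z _ => hB z
      mul_max_le := by simp [hab] }
  obtain ⟨x, hx0, hx⟩ := hPL.exists_eq_forall_mem_Icc_hasDerivWithinAt₀
  refine ⟨x, hx0, fun t ht => (hx t ht).continuousWithinAt, fun t ht => ?_⟩
  exact (hx t ⟨ht.1, ht.2.le⟩).mono_of_mem_nhdsWithin (Icc_mem_nhdsGE_of_mem ht)

/-- This makes the autonomous systems a special case, so existence and growth are proved only for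
seasonal ones. -/
theorem seasonal_self (X : ℂ → ℂ) : seasonal X X = autonomous X := by
  funext t z
  simp [seasonal, autonomous]

theorem seasonal_eq_of_floor {X₁ X₂ : ℂ → ℂ} {t : ℝ} {n : ℤ} (h : ⌊t⌋ = n) :
    seasonal X₁ X₂ t = if Even n then X₁ else X₂ := by
  funext z
  simp only [seasonal, h]
  split_ifs <;> rfl

theorem exists_isForwardSolution_seasonal {g₁ g₂ : ℂ → ℂ} {K₁ K₂ B₁ B₂ : NNReal}
    (h₁ : LipschitzWith K₁ g₁) (hB₁ : ∀ z, ‖g₁ z‖ ≤ B₁)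
    (h₂ : LipschitzWith K₂ g₂) (hB₂ : ∀ z, ‖g₂ z‖ ≤ B₂) (t₀ : ℝ) (z : ℂ) :
    ∃ x : ℝ → ℂ, x t₀ = z ∧ IsForwardSolution (seasonal g₁ g₂) t₀ x := by
  -- The pieces break at `t₀` and then at the integers above it, so that each lies in a single
  -- season.
  let τ : ℕ → ℝ := fun n => if n = 0 then t₀ else ⌊t₀⌋ + n
  have hτ1 : ∀ n, τ (n + 1) = ⌊t₀⌋ + n + 1 := fun n => by simp [τ, add_assoc]
  have hτ0 : ∀ n : ℕ, (⌊t₀⌋ : ℝ) + n ≤ τ n := by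
    intro n
    cases n with
    | zero => simpa [τ] using Int.floor_le t₀
    | succ n => rw [hτ1]; push_cast; linarith
  have hlt : ∀ n, τ n < τ (n + 1) := by
    intro n
    cases n with
    | zero => rw [hτ1]; simp [τ]
    | succ n => rw [hτ1, hτ1]; push_cast; linarith
  have hτ : StrictMono τ := strictMono_nat_of_lt_succ hlt
  have hlim : Tendsto τ atTop atTop :=
    tendsto_atTop_mono hτ0 (tendsto_atTop_add_const_left _ _ tendsto_natCast_atTop_atTop)
  refine exists_isForwardSolution_of_pieces (τ := τ) hτ hlim (fun n v => ?_) z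
  have hfl : ∀ t ∈ Set.Ico (τ n) (τ (n + 1)), ⌊t⌋ = ⌊t₀⌋ + n := by
    intro t ht
    rw [Int.floor_eq_iff]
    push_cast
    exact ⟨(hτ0 n).trans ht.1, by rw [← hτ1]; exact ht.2⟩
  by_cases he : Even (⌊t₀⌋ + (n : ℤ))
  · obtain ⟨x, hx0, hx⟩ := exists_isSolutionOn_autonomous h₁ hB₁ (hlt n).le v
    refine ⟨x, hx0, hx.congr_field fun t ht => ?_⟩
    rw [seasonal_eq_of_floor (hfl t ht), if_pos he]
    rfl
  · obtain ⟨x, hx0, hx⟩ := exists_isSolutionOn_autonomous h₂ hB₂ (hlt n).le v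
    refine ⟨x, hx0, hx.congr_field fun t ht => ?_⟩
    rw [seasonal_eq_of_floor (hfl t ht), if_neg he]
    rfl

theorem exists_lipschitz_bounded_cutoff {X : ℂ → ℂ} (hX : ContDiff ℝ 1 X) {R : ℝ} (hR : 0 < R) :
    ∃ (g : ℂ → ℂ) (K B : NNReal), LipschitzWith K g ∧ (∀ z, ‖g z‖ ≤ B) ∧
      ∀ z, ‖z‖ ≤ R → g z = X z := by
  let ψ : ContDiffBump (0 : ℂ) := ⟨R, R + 1, hR, by linarith⟩
  have hc : HasCompactSupport fun z => ψ z • X z := ψ.hasCompactSupport.smul_right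
  have hd : ContDiff ℝ 1 fun z => ψ z • X z := ψ.contDiff.smul hX
  obtain ⟨K, hK⟩ := hd.lipschitzWith_of_hasCompactSupport hc one_ne_zero
  obtain ⟨B, hB⟩ := hc.exists_bound_of_continuous hd.continuous
  refine ⟨_, K, B.toNNReal, hK, fun z => (hB z).trans (Real.le_coe_toNNReal B), fun z hz => ?_⟩
  rw [ψ.one_of_mem_closedBall (by simpa using hz), one_smul]

theorem hasGlobalCutoffs_seasonal {X₁ X₂ : ℂ → ℂ} (h₁ : ContDiff ℝ 1 X₁) (h₂ : ContDiff ℝ 1 X₂) :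
    HasGlobalCutoffs (seasonal X₁ X₂) := by
  intro R
  have hR : 0 < max R 1 := by positivity
  obtain ⟨g₁, K₁, B₁, hK₁, hB₁, hg₁⟩ := exists_lipschitz_bounded_cutoff h₁ hR
  obtain ⟨g₂, K₂, B₂, hK₂, hB₂, hg₂⟩ := exists_lipschitz_bounded_cutoff h₂ hR
  refine ⟨seasonal g₁ g₂, fun t z hz => ?_, fun t₀ _ z =>
    exists_isForwardSolution_seasonal hK₁ hB₁ hK₂ hB₂ t₀ z⟩
  have hz' := hz.trans (le_max_left R 1)
  simp only [seasonal, hg₁ z hz', hg₂ z hz']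

theorem exists_lipschitzOnWith_closedBall {X : ℂ → ℂ} (hX : ContDiff ℝ 1 X) {R : ℝ} (hR : 0 < R) :
    ∃ K : NNReal, LipschitzOnWith K X (Metric.closedBall 0 R) := by
  obtain ⟨g, K, B, hK, -, hg⟩ := exists_lipschitz_bounded_cutoff hX hR
  refine ⟨K, fun z hz w hw => ?_⟩
  rw [← hg z (by simpa using hz), ← hg w (by simpa using hw)]
  exact hK z w

theorem exists_hasLinearGrowth_seasonal {X₁ X₂ : ℂ → ℂ} (h₁ : ContDiff ℝ 1 X₁)
    (h₂ : ContDiff ℝ 1 X₂) (h₁0 : X₁ 0 = 0) (h₂0 : X₂ 0 = 0) :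
    ∃ K : ℝ, 0 ≤ K ∧ HasLinearGrowth (seasonal X₁ X₂) K 1 := by
  obtain ⟨K₁, hK₁⟩ := exists_lipschitzOnWith_closedBall h₁ one_pos
  obtain ⟨K₂, hK₂⟩ := exists_lipschitzOnWith_closedBall h₂ one_pos
  have key : ∀ (X : ℂ → ℂ) (K : NNReal), X 0 = 0 → LipschitzOnWith K X (Metric.closedBall 0 1) →
      ∀ z, ‖z‖ ≤ 1 → ‖X z‖ ≤ K * ‖z‖ := by
    intro X K h0 hK z hz
    have := hK.dist_le_mul z (by simpa using hz) 0 (by simp)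
    rwa [h0, dist_zero_right, dist_zero_right] at this
  refine ⟨max K₁ K₂, by positivity, fun t z hz => ?_⟩
  simp only [seasonal]
  split_ifs
  · exact (key _ _ h₁0 hK₁ z hz).trans
      (mul_le_mul_of_nonneg_right (le_max_left _ _) (norm_nonneg _))
  · exact (key _ _ h₂0 hK₂ z hz).trans
      (mul_le_mul_of_nonneg_right (le_max_right _ _) (norm_nonneg _))

/-! ### Fourth order normal forms -/

/-- The planar map `λ z + b z² + c z z̄ + d z² z̄`. -/
def cubicMap (l b c d z : ℂ) : ℂ :=
  l * z + b * z ^ 2 + c * (z * (starRingEnd ℂ) z) + d * (z ^ 2 * (starRingEnd ℂ) z)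

/-- The real polynomial `|z|² + 2 Re (β z² z̄ + δ z³ z̄)`. -/
def quarticForm (β δ z : ℂ) : ℝ :=
  (z * (starRingEnd ℂ) z + 2 * (β * (z ^ 2 * (starRingEnd ℂ) z)
    + δ * (z ^ 3 * (starRingEnd ℂ) z))).re

theorem quarticForm_eq (β δ z : ℂ) :
    ((quarticForm β δ z : ℝ) : ℂ) = z * (starRingEnd ℂ) z
      + (β * (z ^ 2 * (starRingEnd ℂ) z) + (starRingEnd ℂ) β * (z * (starRingEnd ℂ) z ^ 2))
      + (δ * (z ^ 3 * (starRingEnd ℂ) z) + (starRingEnd ℂ) δ * (z * (starRingEnd ℂ) z ^ 3)) := by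
  rw [quarticForm, Complex.re_eq_add_conj]
  simp only [map_add, map_mul, map_pow, Complex.conj_conj, map_ofNat]
  ring

theorem isComparable_quarticForm (β δ : ℂ) : IsComparable (quarticForm β δ) := by
  refine ⟨min 1 (1 / (4 * (‖β‖ + ‖δ‖ + 1))), by positivity, fun z hz => ?_⟩
  have h1 := (hz.trans_le (min_le_left _ _)).le
  have h2 := hz.trans_le (min_le_right _ _)
  rw [lt_div_iff₀ (by positivity)] at h2
  set q := β * (z ^ 2 * (starRingEnd ℂ) z) + δ * (z ^ 3 * (starRingEnd ℂ) z) with hq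
  have h3 : quarticForm β δ z = ‖z‖ ^ 2 + 2 * q.re := by
    rw [quarticForm, ← hq, Complex.add_re, Complex.mul_conj, Complex.ofReal_re,
      Complex.normSq_eq_norm_sq]
    simp
  have h4 : ‖q‖ ≤ (‖β‖ + ‖δ‖) * ‖z‖ * ‖z‖ ^ 2 := by
    refine (norm_add_le _ _).trans ?_
    simp only [norm_mul, norm_pow, RCLike.norm_conj]
    have h5 : ‖z‖ ^ 3 * ‖z‖ ≤ ‖z‖ ^ 3 := mul_le_of_le_one_right (by positivity) h1
    have h6 := mul_le_mul_of_nonneg_left h5 (norm_nonneg δ)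
    nlinarith
  have h5 := abs_le.1 (Complex.abs_re_le_norm q)
  have h6 : (‖β‖ + ‖δ‖) * ‖z‖ * ‖z‖ ^ 2 ≤ 1 / 4 * ‖z‖ ^ 2 := by
    gcongr
    nlinarith [norm_nonneg z]
  rw [h3]
  constructor <;> linarith [sq_nonneg ‖z‖]

/-! ### Expansion of the quartic form in powers of `z` -/

section BigO

variable {ι : Type*} {l : Filter ι} {z : ι → ℂ}

theorem isBigO_pow_mono (hz : Tendsto z l (𝓝 0)) {f : ι → ℂ} {m n : ℕ} (hmn : m ≤ n)
    (hf : f =O[l] fun i => z i ^ n) : f =O[l] fun i => z i ^ m := by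
  refine hf.trans ?_
  have h1 : (fun i => z i ^ (n - m)) =O[l] fun _ => (1 : ℂ) := (hz.pow (n - m)).isBigO_one ℂ
  have h2 := (isBigO_refl (fun i => z i ^ m) l).mul h1
  refine (h2.congr (fun i => ?_) fun i => mul_one _)
  rw [← pow_add, Nat.add_sub_cancel' hmn]

theorem isBigO_pow_mul {f g : ι → ℂ} {m n k : ℕ} (hf : f =O[l] fun i => z i ^ m)
    (hg : g =O[l] fun i => z i ^ n) (hk : m + n = k) :
    (fun i => f i * g i) =O[l] fun i => z i ^ k := by
  simpa only [← pow_add, hk] using hf.mul hg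

theorem isBigO_conj {f : ι → ℂ} {g : ι → ℂ} (hf : f =O[l] g) :
    (fun i => (starRingEnd ℂ) (f i)) =O[l] g :=
  (isBigO_norm_left.1 (by simpa using hf.norm_left))

theorem isBigO_const_mul {f : ι → ℂ} {g : ι → ℂ} (c : ℂ) (hf : f =O[l] g) :
    (fun i => c * f i) =O[l] g := hf.const_mul_left c

/-- Along a map whose `3`-jet is a `cubicMap`, a suitable quartic form changes by `κ |z|⁴`
up to terms of order five. -/
theorem quarticForm_isBigO (hz : Tendsto z l (𝓝 0)) {p : ι → ℂ} {lam b c d β δ : ℂ} {κ : ℝ}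
    (hp : (fun i => p i - cubicMap lam b c d (z i)) =O[l] fun i => z i ^ 4)
    (hlam : lam * (starRingEnd ℂ) lam = 1)
    (hβ : lam * (starRingEnd ℂ) c + b * (starRingEnd ℂ) lam + β * (lam - 1) = 0)
    (hδ : b * (starRingEnd ℂ) c + β * (2 * b + lam ^ 2 * (starRingEnd ℂ) c)
      + δ * (lam ^ 2 - 1) = 0)
    (hκ : lam * (starRingEnd ℂ) d + (starRingEnd ℂ) lam * d + b * (starRingEnd ℂ) b
      + c * (starRingEnd ℂ) c + β * (2 * c + lam ^ 2 * (starRingEnd ℂ) b)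
      + (starRingEnd ℂ) β * (2 * (starRingEnd ℂ) c + (starRingEnd ℂ) lam ^ 2 * b) = κ) :
    (fun i => ((quarticForm β δ (p i) - quarticForm β δ (z i) - κ * ‖z i‖ ^ 4 : ℝ) : ℂ))
      =O[l] fun i => z i ^ 5 := by
  have hz1 : z =O[l] fun i => z i ^ 1 := by simpa using isBigO_refl z l
  have hw1 : (fun i => (starRingEnd ℂ) (z i)) =O[l] fun i => z i ^ 1 := isBigO_conj hz1
  -- The point `p` splits by order as `u + v + w + r`; `A` and `B` are the tails starting at orders
  -- 2 and 3. The bounds `e2`, `e3`, `e4` collect the terms of order at least 5 in `|p|²`, `p² p̄`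
  -- and `p³ p̄`.
  set u : ι → ℂ := fun i => lam * z i with hu
  set v : ι → ℂ := fun i => b * z i ^ 2 + c * (z i * (starRingEnd ℂ) (z i)) with hv
  set w : ι → ℂ := fun i => d * (z i ^ 2 * (starRingEnd ℂ) (z i)) with hw
  set B : ι → ℂ := fun i => p i - u i - v i with hB
  set A : ι → ℂ := fun i => p i - u i with hA
  set r : ι → ℂ := fun i => p i - u i - v i - w i with hr
  have hu1 : u =O[l] fun i => z i ^ 1 := hz1.const_mul_left _
  have hv2 : v =O[l] fun i => z i ^ 2 := by
    refine .add (.const_mul_left (isBigO_refl _ _) _) (.const_mul_left ?_ _)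
    exact isBigO_pow_mul hz1 hw1 rfl
  have hw3 : w =O[l] fun i => z i ^ 3 :=
    .const_mul_left (isBigO_pow_mul (isBigO_refl _ _) hw1 rfl) _
  have hr4 : r =O[l] fun i => z i ^ 4 := by
    refine hp.congr_left fun i => ?_
    simp only [hr, hu, hv, hw, cubicMap]
    ring
  have hB3 : B =O[l] fun i => z i ^ 3 := by
    refine (hw3.add (isBigO_pow_mono hz (by norm_num) hr4)).congr_left fun i => ?_
    simp only [hr, hB]
    ring
  have hA2 : A =O[l] fun i => z i ^ 2 := by
    refine (hv2.add (isBigO_pow_mono hz (by norm_num) hB3)).congr_left fun i => ?_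
    simp only [hA, hB]
    ring
  have hp1 : p =O[l] fun i => z i ^ 1 := by
    refine (hu1.add (isBigO_pow_mono hz (by norm_num) hA2)).congr_left fun i => ?_
    simp only [hA]
    ring
  have hu1' := isBigO_conj hu1
  have hv2' := isBigO_conj hv2
  have hr4' := isBigO_conj hr4
  have hB3' := isBigO_conj hB3
  have hA2' := isBigO_conj hA2
  have hp1' := isBigO_conj hp1
  have e2 : (fun i => u i * (starRingEnd ℂ) (r i) + r i * (starRingEnd ℂ) (u i)
      + v i * (starRingEnd ℂ) (B i) + B i * (starRingEnd ℂ) (A i)) =O[l] fun i => z i ^ 5 :=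
    ((((isBigO_pow_mul hu1 hr4' rfl).add (isBigO_pow_mul hr4 hu1' rfl)).add
      (isBigO_pow_mul hv2 hB3' rfl)).add (isBigO_pow_mul hB3 hA2' rfl))
  have e3 : (fun i => p i ^ 2 * (starRingEnd ℂ) (p i) - u i ^ 2 * (starRingEnd ℂ) (u i)
      - (2 * (u i * v i) * (starRingEnd ℂ) (u i) + u i ^ 2 * (starRingEnd ℂ) (v i)))
      =O[l] fun i => z i ^ 5 := by
    have t1 := (isBigO_pow_mul (isBigO_pow_mul hu1 hB3 rfl) hu1' rfl).const_mul_left 2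
    have t2 := isBigO_pow_mul (isBigO_pow_mul hA2 hA2 rfl) hp1' rfl
    have t3 := isBigO_pow_mul (isBigO_pow_mul hu1 hu1 rfl) hB3' rfl
    have t4 := (isBigO_pow_mul (isBigO_pow_mul hu1 hA2 rfl) hA2' rfl).const_mul_left 2
    refine (((t1.add t2).add t3).add t4).congr_left fun i => ?_
    simp only [hA, hB, map_sub]
    ring
  have e4 : (fun i => p i ^ 3 * (starRingEnd ℂ) (p i) - u i ^ 3 * (starRingEnd ℂ) (u i))
      =O[l] fun i => z i ^ 5 := by
    have t1 := isBigO_pow_mul (isBigO_pow_mul (isBigO_pow_mul hu1 hu1 rfl) hu1 rfl) hA2' rfl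
    have t2 := isBigO_pow_mul (isBigO_pow_mul hA2
      (((isBigO_pow_mul hp1 hp1 rfl).add (isBigO_pow_mul hp1 hu1 rfl)).add
      (isBigO_pow_mul hu1 hu1 rfl)) rfl) hp1' rfl
    refine (t1.add t2).congr_left fun i => ?_
    simp only [hA, map_sub]
    ring
  have total := (e2.add ((e3.const_mul_left β).add
    (isBigO_const_mul ((starRingEnd ℂ) β) (isBigO_conj e3)))).add
    ((e4.const_mul_left δ).add (isBigO_const_mul ((starRingEnd ℂ) δ) (isBigO_conj e4)))
  refine total.congr_left fun i => ?_
  have hn : ((‖z i‖ : ℝ) : ℂ) ^ 4 = (z i * (starRingEnd ℂ) (z i)) ^ 2 := by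
    rw [Complex.mul_conj, Complex.normSq_eq_norm_sq]
    push_cast
    ring
  push_cast
  rw [quarticForm_eq, quarticForm_eq, hn]
  have hβ' := congrArg (starRingEnd ℂ) hβ
  have hδ' := congrArg (starRingEnd ℂ) hδ
  simp only [map_add, map_sub, map_mul, map_pow, Complex.conj_conj, map_ofNat, map_one,
    map_zero] at hβ' hδ'
  simp only [hA, hB, hr, hu, hv, hw, map_add, map_sub, map_mul, map_pow, Complex.conj_conj,
    map_ofNat]
  generalize (starRingEnd ℂ) (p i) = P
  generalize p i = Q
  generalize (starRingEnd ℂ) (z i) = W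
  generalize z i = Z
  generalize (starRingEnd ℂ) lam = L at *
  generalize (starRingEnd ℂ) b = b' at *
  generalize (starRingEnd ℂ) c = c' at *
  generalize (starRingEnd ℂ) d = d' at *
  generalize (starRingEnd ℂ) β = β' at *
  generalize (starRingEnd ℂ) δ = δ' at *
  -- Order by order: `hlam` removes `z z̄`, `hβ` removes `z² z̄`, `hδ` removes `z³ z̄` (with
  -- conjugates), and `hκ` identifies the coefficient of `|z|⁴`.
  linear_combination
    -(Z * W * hlam) - Z ^ 2 * W * (hβ + β * lam * hlam) - Z * W ^ 2 * (hβ' + β' * L * hlam)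
    - Z ^ 3 * W * (hδ + 2 * β * b * hlam + δ * lam ^ 2 * hlam)
    - Z * W ^ 3 * (hδ' + 2 * β' * b' * hlam + δ' * L ^ 2 * hlam)
    - Z ^ 2 * W ^ 2 * (hκ + 2 * β * c * hlam + 2 * β' * c' * hlam)

end BigO

/-- `V` changes by about `κ |z|⁴` from `z` to any point `O(|z|⁴)`-close to `G z`. -/
def ChangesBy (V : ℂ → ℝ) (G : ℂ → ℂ) (κ : ℝ) : Prop :=
  ∀ A : ℝ, ∃ r : ℝ, 0 < r ∧ ∀ z p : ℂ, ‖z‖ < r → ‖p - G z‖ ≤ A * ‖z‖ ^ 4 →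
    |V p - V z - κ * ‖z‖ ^ 4| ≤ |κ| / 2 * ‖z‖ ^ 4

theorem changesBy_quarticForm {lam b c d β δ : ℂ} {κ : ℝ} (hκ0 : κ ≠ 0)
    (hlam : lam * (starRingEnd ℂ) lam = 1)
    (hβ : lam * (starRingEnd ℂ) c + b * (starRingEnd ℂ) lam + β * (lam - 1) = 0)
    (hδ : b * (starRingEnd ℂ) c + β * (2 * b + lam ^ 2 * (starRingEnd ℂ) c)
      + δ * (lam ^ 2 - 1) = 0)
    (hκ : lam * (starRingEnd ℂ) d + (starRingEnd ℂ) lam * d + b * (starRingEnd ℂ) b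
      + c * (starRingEnd ℂ) c + β * (2 * c + lam ^ 2 * (starRingEnd ℂ) b)
      + (starRingEnd ℂ) β * (2 * (starRingEnd ℂ) c + (starRingEnd ℂ) lam ^ 2 * b) = κ) :
    ChangesBy (quarticForm β δ) (cubicMap lam b c d) κ := by
  intro A
  set S : Set (ℂ × ℂ) := {q | ‖q.2 - cubicMap lam b c d q.1‖ ≤ A * ‖q.1‖ ^ 4}
  -- Letting the pair `(z, p)` vary, with `z → 0` and `p` constrained by `S`, makes the estimate
  -- uniform over all points `p` close to the image of `z`.
  set l : Filter (ℂ × ℂ) := comap Prod.fst (𝓝 0) ⊓ 𝓟 S with hl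
  have hz : Tendsto (fun q : ℂ × ℂ => q.1) l (𝓝 0) := tendsto_comap.mono_left inf_le_left
  have hp : (fun q : ℂ × ℂ => q.2 - cubicMap lam b c d q.1) =O[l] fun q => q.1 ^ 4 := by
    refine IsBigO.of_bound A ?_
    filter_upwards [mem_inf_of_right (mem_principal_self S)] with q hq
    rw [norm_pow]
    exact hq
  have h1 := quarticForm_isBigO hz hp hlam hβ hδ hκ
  have h2 : (fun q : ℂ × ℂ => q.1 ^ 5) =o[l] fun q => q.1 ^ 4 := by
    have := ((isLittleO_one_iff ℂ).2 hz).mul_isBigO (isBigO_refl (fun q : ℂ × ℂ => q.1 ^ 4) l)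
    refine this.congr (fun q => by ring) fun q => by ring
  have h3 := (h1.trans_isLittleO h2).bound (show 0 < |κ| / 2 by positivity)
  rw [hl, eventually_inf_principal, eventually_comap] at h3
  obtain ⟨r, hr, hball⟩ := Metric.eventually_nhds_iff.1 h3
  refine ⟨r, hr, fun z p hz hzp => ?_⟩
  have := hball (by simpa using hz) (z, p) rfl hzp
  simpa only [Complex.norm_real, Real.norm_eq_abs, norm_pow] using this

/-- The equation for `δ` is solved by dividing by `lam ^ 2 - 1`; `β` remains an input because it
enters the value of `κ`. -/
theorem exists_changesBy_cubicMap {lam b c d β : ℂ} {κ : ℝ} (hκ0 : κ ≠ 0)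
    (hlam : lam * (starRingEnd ℂ) lam = 1) (hlam2 : lam ^ 2 ≠ 1)
    (hβ : lam * (starRingEnd ℂ) c + b * (starRingEnd ℂ) lam + β * (lam - 1) = 0)
    (hκ : lam * (starRingEnd ℂ) d + (starRingEnd ℂ) lam * d + b * (starRingEnd ℂ) b
      + c * (starRingEnd ℂ) c + β * (2 * c + lam ^ 2 * (starRingEnd ℂ) b)
      + (starRingEnd ℂ) β * (2 * (starRingEnd ℂ) c + (starRingEnd ℂ) lam ^ 2 * b) = κ) :
    ∃ V : ℂ → ℝ, IsComparable V ∧ ChangesBy V (cubicMap lam b c d) κ := by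
  have hne : lam ^ 2 - 1 ≠ 0 := sub_ne_zero.2 hlam2
  refine ⟨_, isComparable_quarticForm β _, changesBy_quarticForm hκ0 hlam hβ (δ :=
    -(b * (starRingEnd ℂ) c + β * (2 * b + lam ^ 2 * (starRingEnd ℂ) c)) / (lam ^ 2 - 1)) ?_ hκ⟩
  field_simp
  ring

/-- The `3`-jet of the composition of maps with `3`-jets `l₁ z + b z² + c z z̄ + d z² z̄` and
`l₂ z + e z² z̄`. -/
theorem cubicMap_comp_jet (l₁ b c d l₂ e : ℂ) (A₁ A₂ : ℝ) :
    ∃ A r : ℝ, 0 < r ∧ ∀ z p q : ℂ, ‖z‖ < r → ‖p - cubicMap l₁ b c d z‖ ≤ A₁ * ‖z‖ ^ 4 →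
      ‖q - cubicMap l₂ 0 0 e p‖ ≤ A₂ * ‖p‖ ^ 4 →
      ‖q - cubicMap (l₂ * l₁) (l₂ * b) (l₂ * c)
        (l₂ * d + e * (l₁ ^ 2 * (starRingEnd ℂ) l₁)) z‖ ≤ A * ‖z‖ ^ 4 := by
  set S : Set (ℂ × ℂ × ℂ) := {i | ‖i.2.1 - cubicMap l₁ b c d i.1‖ ≤ A₁ * ‖i.1‖ ^ 4 ∧
    ‖i.2.2 - cubicMap l₂ 0 0 e i.2.1‖ ≤ A₂ * ‖i.2.1‖ ^ 4} with hS
  set l : Filter (ℂ × ℂ × ℂ) := comap Prod.fst (𝓝 0) ⊓ 𝓟 S with hl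
  set z : ℂ × ℂ × ℂ → ℂ := fun i => i.1 with hzdef
  have hz : Tendsto z l (𝓝 0) := tendsto_comap.mono_left inf_le_left
  have hp : (fun i => i.2.1 - cubicMap l₁ b c d i.1) =O[l] fun i => z i ^ 4 := by
    refine IsBigO.of_bound A₁ ?_
    filter_upwards [mem_inf_of_right (mem_principal_self S)] with q hq
    simpa [z] using hq.1
  have hq : (fun i => i.2.2 - cubicMap l₂ 0 0 e i.2.1) =O[l] fun i => i.2.1 ^ 4 := by
    refine IsBigO.of_bound A₂ ?_
    filter_upwards [mem_inf_of_right (mem_principal_self S)] with q hq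
    simpa [z] using hq.2
  have hz1 : z =O[l] fun i => z i ^ 1 := by simpa using isBigO_refl z l
  have hw1 : (fun i => (starRingEnd ℂ) (z i)) =O[l] fun i => z i ^ 1 := isBigO_conj hz1
  have hzw := isBigO_pow_mul hz1 hw1 rfl
  have hzzw := isBigO_pow_mul (isBigO_pow_mul hz1 hz1 rfl) hw1 rfl
  have hA2 : (fun i => i.2.1 - l₁ * z i) =O[l] fun i => z i ^ 2 := by
    have t1 := (isBigO_refl (fun i => z i ^ 2) l).const_mul_left b
    have t2 := hzw.const_mul_left c
    have t3 := isBigO_pow_mono hz (m := 2) (by norm_num) (hzzw.const_mul_left d)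
    have t4 := isBigO_pow_mono hz (m := 2) (by norm_num) hp
    refine (((t1.add t2).add t3).add t4).congr_left fun i => ?_
    simp only [cubicMap, z]
    ring
  have hp1 : (fun i : ℂ × ℂ × ℂ => i.2.1) =O[l] fun i => z i ^ 1 := by
    refine ((hz1.const_mul_left l₁).add
      (isBigO_pow_mono hz (by norm_num) hA2)).congr_left fun i => ?_
    ring
  have hu1 := hz1.const_mul_left l₁
  have hq4 : (fun i => i.2.2 - cubicMap l₂ 0 0 e i.2.1) =O[l] fun i => z i ^ 4 := by
    refine hq.trans ?_
    simpa using hp1.pow 4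
  have t1 := isBigO_pow_mul (isBigO_pow_mul hA2 hp1 rfl) (isBigO_conj hp1) rfl
  have t2 := isBigO_pow_mul (isBigO_pow_mul hA2 hu1 rfl) (isBigO_conj hp1) rfl
  have t3 := isBigO_pow_mul (isBigO_pow_mul hu1 hu1 rfl) (isBigO_conj hA2) rfl
  have total := (hq4.add (hp.const_mul_left l₂)).add (((t1.add t2).add t3).const_mul_left e)
  have hfin : (fun i : ℂ × ℂ × ℂ => i.2.2 - cubicMap (l₂ * l₁) (l₂ * b) (l₂ * c)
      (l₂ * d + e * (l₁ ^ 2 * (starRingEnd ℂ) l₁)) i.1) =O[l] fun i => z i ^ 4 := by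
    refine total.congr_left fun i => ?_
    simp only [cubicMap, z, map_sub, map_mul]
    ring
  obtain ⟨A, hA⟩ := hfin.bound
  rw [hl, eventually_inf_principal, eventually_comap] at hA
  obtain ⟨r, hr, hball⟩ := Metric.eventually_nhds_iff.1 hA
  refine ⟨A, r, hr, fun z p q hz hzp hpq => ?_⟩
  simpa only [norm_pow] using hball (by simpa using hz) (z, p, q) rfl ⟨hzp, hpq⟩

/-! ### Time translation and time reversal -/

theorem IsSolutionOn.translate {X : ℂ → ℂ} {s : ℝ} {x : ℝ → ℂ}
    (hx : IsSolutionOn (autonomous X) s (s + 1) x) :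
    IsSolutionOn (autonomous X) 0 1 fun t => x (s + t) := by
  constructor
  · refine hx.1.comp (by fun_prop) fun t ht => ?_
    exact ⟨by linarith [ht.1], by linarith [ht.2]⟩
  · intro t ht
    have h1 := hx.2 (s + t) ⟨by linarith [ht.1], by linarith [ht.2]⟩
    have h2 : HasDerivWithinAt (fun t : ℝ => s + t) 1 (Set.Ici t) t :=
      ((hasDerivAt_id t).const_add s).hasDerivWithinAt
    have h3 := h1.scomp t h2 (fun u hu => by
      simp only [Set.mem_Ici] at hu ⊢
      linarith)
    exact h3.congr_deriv (by simp [autonomous])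

/-- A solution equals its Picard integral, which is differentiable from both sides. The left
derivative is what time reversal turns into the right derivative demanded of a solution. -/
theorem IsSolutionOn.hasDerivWithinAt_Icc {X : ℂ → ℂ} (hX : Continuous X) {a b : ℝ} {x : ℝ → ℂ}
    (hx : IsSolutionOn (autonomous X) a b x) {t : ℝ} (ht : t ∈ Set.Icc a b) :
    HasDerivWithinAt x (X (x t)) (Set.Icc a b) t := by
  have hab : a ≤ b := ht.1.trans ht.2
  have h1 := ODE.hasDerivWithinAt_picard_Icc (f := fun _ : ℝ => X) (t₀ := a) (u := Set.univ)
    ⟨le_rfl, hab⟩ (by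
      have : Continuous (Function.uncurry fun _ : ℝ => X) := hX.comp continuous_snd
      exact this.continuousOn) hx.1 (fun _ _ => trivial) (x a) ht
  have hcont : ContinuousOn (fun s => X (x s)) (Set.Icc a b) := hX.comp_continuousOn hx.1
  have h2 : ∀ s ∈ Set.Icc a b, x s = ODE.picard (fun _ : ℝ => X) a (x a) x s := by
    intro s hs
    rw [ODE.picard_apply, intervalIntegral.integral_eq_sub_of_hasDeriv_right_of_le hs.1
      (hx.1.mono (Set.Icc_subset_Icc_right hs.2))]
    · ring
    · intro u hu
      exact (hx.2 u ⟨hu.1.le, hu.2.trans_le hs.2⟩).mono Set.Ioi_subset_Ici_self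
    · apply ContinuousOn.intervalIntegrable
      rw [Set.uIcc_of_le hs.1]
      exact hcont.mono (Set.Icc_subset_Icc_right hs.2)
  exact h1.congr h2 (h2 t ht)

theorem IsSolutionOn.reverse {X : ℂ → ℂ} (hX : Continuous X) {s : ℝ} {x : ℝ → ℂ}
    (hx : IsSolutionOn (autonomous fun z => -X z) s (s + 1) x) :
    IsSolutionOn (autonomous X) 0 1 fun t => x (s + 1 - t) := by
  constructor
  · refine hx.1.comp (by fun_prop) fun t ht => ?_
    exact ⟨by linarith [ht.2], by linarith [ht.1]⟩
  · intro t ht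
    have h1 := hx.hasDerivWithinAt_Icc hX.neg (t := s + 1 - t)
      ⟨by linarith [ht.2], by linarith [ht.1]⟩
    have h2 : HasDerivWithinAt (fun t : ℝ => s + 1 - t) (-1) (Set.Icc 0 1) t :=
      ((hasDerivAt_id t).const_sub (s + 1)).hasDerivWithinAt
    have h3 := h1.scomp t h2 (fun u hu => ⟨by linarith [hu.2], by linarith [hu.1]⟩)
    have h4 := h3.mono_of_mem_nhdsWithin (Icc_mem_nhdsGE_of_mem ht)
    exact h4.congr_deriv (by simp [autonomous])

theorem TimeOneMapEq.forward {X F : ℂ → ℂ} (h : TimeOneMapEq X F 4) :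
    ∃ A ρ : ℝ, 0 < ρ ∧ ∀ (s : ℝ) (x : ℝ → ℂ), IsSolutionOn (autonomous X) s (s + 1) x →
      ‖x s‖ < ρ → ‖x (s + 1) - F (x s)‖ ≤ A * ‖x s‖ ^ 4 := by
  obtain ⟨A, ρ, hρ, h⟩ := h
  refine ⟨A, ρ, hρ, fun s x hx h0 => ?_⟩
  exact (h (x s) h0).2 _ (by simp) hx.translate

theorem TimeOneMapEq.backward {X F : ℂ → ℂ} (hX : Continuous X) (h : TimeOneMapEq X F 4) :
    ∃ A ρ : ℝ, 0 < ρ ∧ ∀ (s : ℝ) (x : ℝ → ℂ),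
      IsSolutionOn (autonomous fun z => -X z) s (s + 1) x →
      ‖x (s + 1)‖ < ρ → ‖x s - F (x (s + 1))‖ ≤ A * ‖x (s + 1)‖ ^ 4 := by
  obtain ⟨A, ρ, hρ, h⟩ := h
  refine ⟨A, ρ, hρ, fun s x hx h0 => ?_⟩
  simpa using (h (x (s + 1)) h0).2 _ (by simp) (hx.reverse hX)

/-! ### Stability from the jet of the period map -/

/-- The period map at the times `a + p n` is `G(z) + O(|z|⁴)`. -/
def HasForwardJet (f : ℝ → ℂ → ℂ) (a p : ℝ) (G : ℂ → ℂ) : Prop :=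
  ∃ A ρ : ℝ, 0 < ρ ∧ ∀ (n : ℕ) (x : ℝ → ℂ), IsSolutionOn f (a + p * n) (a + p * n + p) x →
    ‖x (a + p * n)‖ < ρ → ‖x (a + p * n + p) - G (x (a + p * n))‖ ≤ A * ‖x (a + p * n)‖ ^ 4

/-- The inverse of the period map at the times `a + p n` is `G(z) + O(|z|⁴)`. -/
def HasBackwardJet (f : ℝ → ℂ → ℂ) (a p : ℝ) (G : ℂ → ℂ) : Prop :=
  ∃ A ρ : ℝ, 0 < ρ ∧ ∀ (n : ℕ) (x : ℝ → ℂ), IsSolutionOn f (a + p * n) (a + p * n + p) x →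
    ‖x (a + p * n)‖ < ρ →
    ‖x (a + p * n) - G (x (a + p * n + p))‖ ≤ A * ‖x (a + p * n + p)‖ ^ 4

section Jets

variable {f : ℝ → ℂ → ℂ} {a p K κ : ℝ} {V : ℂ → ℝ} {G : ℂ → ℂ}

theorem isLAS_of_forwardJet (hf : HasLinearGrowth f K 1) (hK : 0 ≤ K) (hcut : HasGlobalCutoffs f)
    (ha : 0 ≤ a) (hp : 0 < p) (hV : IsComparable V) (hG : ChangesBy V G κ) (hκ : κ < 0)
    (hj : HasForwardJet f a p G) : IsLAS f 0 := by
  obtain ⟨A, ρ, hρ, hj⟩ := hj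
  obtain ⟨r, hr, hG⟩ := hG A
  refine isLAS_of_sampled_decrease hf hK one_pos hcut ha hp hV (ρ := min ρ r) (c := -κ / 2)
    (by positivity) (by linarith) fun n x hx h0 => ?_
  have h1 := hG _ _ (h0.trans_le (min_le_right _ _)) (hj n x hx (h0.trans_le (min_le_left _ _)))
  rw [abs_of_neg hκ] at h1
  linarith [(abs_le.1 h1).2]

theorem isRepeller_of_forwardJet (hf : HasLinearGrowth f K 1) (hcut : HasGlobalCutoffs f)
    (ha : 0 ≤ a) (hp : 0 < p) (hV : IsComparable V) (hG : ChangesBy V G κ) (hκ : 0 < κ)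
    (hj : HasForwardJet f a p G) : IsRepeller f 0 := by
  obtain ⟨A, ρ, hρ, hj⟩ := hj
  obtain ⟨r, hr, hG⟩ := hG A
  refine isRepeller_of_sampled_increase hf one_pos hcut ha hp hV (ρ := min ρ r) (c := κ / 2)
    (by positivity) (by linarith) fun n x hx h0 => ?_
  have h1 := hG _ _ (h0.trans_le (min_le_right _ _)) (hj n x hx (h0.trans_le (min_le_left _ _)))
  rw [abs_of_pos hκ] at h1
  linarith [(abs_le.1 h1).1]

/-- Over one period, the norm of a small solution changes at most by a constant factor. -/
theorem exists_norm_bounds_over_period (hf : HasLinearGrowth f K 1) (hK : 0 ≤ K) (hp : 0 < p)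
    {r : ℝ} (hr : 0 < r) : ∃ M ρ : ℝ, 0 < M ∧ 0 < ρ ∧ ∀ (s : ℝ) (x : ℝ → ℂ),
      IsSolutionOn f s (s + p) x → ‖x s‖ < ρ → ‖x (s + p)‖ < r ∧ ‖x s‖ ≤ M * ‖x (s + p)‖ := by
  set L := Real.exp ((K + 1) * p) with hL
  have hL0 : 0 < L := Real.exp_pos _
  refine ⟨Real.exp (K * p), min (1 / L) (r / L), Real.exp_pos _, by positivity,
    fun s x hx h0 => ?_⟩
  have h1 := h0.trans_le (min_le_left _ _)
  have h2 := h0.trans_le (min_le_right _ _)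
  rw [lt_div_iff₀ hL0] at h1 h2
  have h3 := hx.norm_le hf hK le_rfl h1
  have hmem : s + p ∈ Set.Icc s (s + p) := ⟨by linarith, le_rfl⟩
  refine ⟨?_, ?_⟩
  · have := h3 _ hmem
    linarith
  · have := hx.norm_ge hf (fun t ht => (h3 t ht).trans (by linarith)) _ hmem
    simpa using this

theorem isRepeller_of_backwardJet (hf : HasLinearGrowth f K 1) (hK : 0 ≤ K)
    (hcut : HasGlobalCutoffs f) (ha : 0 ≤ a) (hp : 0 < p) (hV : IsComparable V)
    (hG : ChangesBy V G κ) (hκ : κ < 0) (hj : HasBackwardJet f a p G) : IsRepeller f 0 := by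
  obtain ⟨A, ρ, hρ, hj⟩ := hj
  obtain ⟨r, hr, hG⟩ := hG A
  obtain ⟨M, σ, hM, hσ, hb⟩ := exists_norm_bounds_over_period hf hK hp hr
  -- The change of `V` is measured by the norm at the end of the period; dividing by `M ^ 4`
  -- expresses it by the norm at the beginning.
  refine isRepeller_of_sampled_increase hf one_pos hcut ha hp hV (ρ := min ρ σ)
    (c := -κ / 2 / M ^ 4) (by positivity)
    (div_pos (by linarith) (by positivity)) fun n x hx h0 => ?_
  obtain ⟨h2, h3⟩ := hb _ x hx (h0.trans_le (min_le_right _ _))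
  have h1 := hG _ _ h2 (hj n x hx (h0.trans_le (min_le_left _ _)))
  rw [abs_of_neg hκ] at h1
  have h4 : -κ / 2 / M ^ 4 * ‖x (a + p * n)‖ ^ 4 ≤ -κ / 2 * ‖x (a + p * n + p)‖ ^ 4 := by
    rw [div_mul_eq_mul_div, div_le_iff₀ (by positivity), mul_assoc]
    refine mul_le_mul_of_nonneg_left ?_ (by linarith)
    calc _ ≤ (M * ‖x (a + p * n + p)‖) ^ 4 := by gcongr
      _ = _ := by ring
  linarith [(abs_le.1 h1).2]

theorem isLAS_of_backwardJet (hf : HasLinearGrowth f K 1) (hK : 0 ≤ K)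
    (hcut : HasGlobalCutoffs f) (ha : 0 ≤ a) (hp : 0 < p) (hV : IsComparable V)
    (hG : ChangesBy V G κ) (hκ : 0 < κ) (hj : HasBackwardJet f a p G) : IsLAS f 0 := by
  obtain ⟨A, ρ, hρ, hj⟩ := hj
  obtain ⟨r, hr, hG⟩ := hG A
  obtain ⟨M, σ, hM, hσ, hb⟩ := exists_norm_bounds_over_period hf hK hp hr
  refine isLAS_of_sampled_decrease hf hK one_pos hcut ha hp hV (ρ := min ρ σ)
    (c := κ / 2 / M ^ 4) (by positivity)
    (div_pos (by linarith) (by positivity)) fun n x hx h0 => ?_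
  obtain ⟨h2, h3⟩ := hb _ x hx (h0.trans_le (min_le_right _ _))
  have h1 := hG _ _ h2 (hj n x hx (h0.trans_le (min_le_left _ _)))
  rw [abs_of_pos hκ] at h1
  have h4 : κ / 2 / M ^ 4 * ‖x (a + p * n)‖ ^ 4 ≤ κ / 2 * ‖x (a + p * n + p)‖ ^ 4 := by
    rw [div_mul_eq_mul_div, div_le_iff₀ (by positivity), mul_assoc]
    refine mul_le_mul_of_nonneg_left ?_ (by linarith)
    calc _ ≤ (M * ‖x (a + p * n + p)‖) ^ 4 := by gcongr
      _ = _ := by ring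
  linarith [(abs_le.1 h1).1]

end Jets

/-! ### From the jets of the seasons to the autonomous and seasonal systems -/

section Systems

variable {X X₁ X₂ : ℂ → ℂ} {V : ℂ → ℝ} {κ : ℝ}

theorem isLAS_autonomous {F : ℂ → ℂ} (hX : ContDiff ℝ 1 X) (hX0 : X 0 = 0)
    (hF : TimeOneMapEq X F 4) (hV : IsComparable V) (hG : ChangesBy V F κ) (hκ : κ < 0) :
    IsLAS (autonomous X) 0 := by
  obtain ⟨K, hK, hgr⟩ := exists_hasLinearGrowth_seasonal hX hX hX0 hX0
  have hcut := hasGlobalCutoffs_seasonal hX hX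
  rw [seasonal_self] at hgr hcut
  obtain ⟨A, ρ, hρ, hj⟩ := hF.forward
  exact isLAS_of_forwardJet hgr hK hcut le_rfl one_pos hV hG hκ ⟨A, ρ, hρ, fun n x => hj _ x⟩

theorem isRepeller_autonomous_neg {F : ℂ → ℂ} (hX : ContDiff ℝ 1 X) (hX0 : X 0 = 0)
    (hF : TimeOneMapEq X F 4) (hV : IsComparable V) (hG : ChangesBy V F κ) (hκ : κ < 0) :
    IsRepeller (autonomous fun z => -X z) 0 := by
  obtain ⟨K, hK, hgr⟩ := exists_hasLinearGrowth_seasonal hX.neg hX.neg (by simp [hX0])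
    (by simp [hX0])
  have hcut := hasGlobalCutoffs_seasonal hX.neg hX.neg
  rw [seasonal_self] at hgr hcut
  obtain ⟨A, r, hr, hj⟩ := hF.backward hX.continuous
  obtain ⟨M, σ, hM, hσ, hb⟩ := exists_norm_bounds_over_period hgr hK one_pos hr
  exact isRepeller_of_backwardJet hgr hK hcut le_rfl one_pos hV hG hκ
    ⟨A, σ, hσ, fun n x hx h0 => hj _ x hx (hb _ x hx h0).1⟩

theorem IsSolutionOn.even_season {s : ℝ} {k : ℤ} (hk : Even k) (hs : s = k) {x : ℝ → ℂ}
    (hx : IsSolutionOn (seasonal X₁ X₂) s (s + 1) x) : IsSolutionOn (autonomous X₁) s (s + 1) x :=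
  hx.congr_field fun t ht => by
    rw [seasonal_eq_of_floor (Int.floor_eq_iff.2 ⟨hs ▸ ht.1, hs ▸ ht.2⟩), if_pos hk]
    rfl

theorem IsSolutionOn.odd_season {s : ℝ} {k : ℤ} (hk : ¬Even k) (hs : s = k) {x : ℝ → ℂ}
    (hx : IsSolutionOn (seasonal X₁ X₂) s (s + 1) x) : IsSolutionOn (autonomous X₂) s (s + 1) x :=
  hx.congr_field fun t ht => by
    rw [seasonal_eq_of_floor (Int.floor_eq_iff.2 ⟨hs ▸ ht.1, hs ▸ ht.2⟩), if_neg hk]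
    rfl

theorem isRepeller_seasonal {l₁ b c d l₂ e : ℂ} (h₁ : ContDiff ℝ 1 X₁) (h₂ : ContDiff ℝ 1 X₂)
    (h₁0 : X₁ 0 = 0) (h₂0 : X₂ 0 = 0) (hF₁ : TimeOneMapEq X₁ (cubicMap l₁ b c d) 4)
    (hF₂ : TimeOneMapEq X₂ (cubicMap l₂ 0 0 e) 4) (hV : IsComparable V)
    (hG : ChangesBy V (cubicMap (l₂ * l₁) (l₂ * b) (l₂ * c)
      (l₂ * d + e * (l₁ ^ 2 * (starRingEnd ℂ) l₁))) κ) (hκ : 0 < κ) :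
    IsRepeller (seasonal X₁ X₂) 0 := by
  obtain ⟨K, hK, hgr⟩ := exists_hasLinearGrowth_seasonal h₁ h₂ h₁0 h₂0
  have hcut := hasGlobalCutoffs_seasonal h₁ h₂
  obtain ⟨A₁, r₁, hr₁, hj₁⟩ := hF₁.forward
  obtain ⟨A₂, r₂, hr₂, hj₂⟩ := hF₂.forward
  obtain ⟨A, r, hr, hcomp⟩ := cubicMap_comp_jet l₁ b c d l₂ e A₁ A₂
  obtain ⟨M, σ, hM, hσ, hb⟩ := exists_norm_bounds_over_period hgr hK one_pos hr₂
  refine isRepeller_of_forwardJet hgr hcut le_rfl two_pos hV hG hκ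
    ⟨A, min (min r r₁) σ, by positivity, fun n x hx h0 => ?_⟩
  set s : ℝ := 0 + 2 * n with hs
  have hs2 : s + 2 = s + 1 + 1 := by ring
  rw [hs2] at hx ⊢
  have hx1 := hx.mono (a' := s) (b' := s + 1) le_rfl (by linarith)
  have hx2 := hx.mono (a' := s + 1) (b' := s + 1 + 1) (by linarith) le_rfl
  refine hcomp _ (x (s + 1)) _ (h0.trans_le ((min_le_left _ _).trans (min_le_left _ _))) ?_ ?_
  · exact hj₁ s x (hx1.even_season (k := 2 * n) (by simp) (by rw [hs]; push_cast; ring))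
      (h0.trans_le ((min_le_left _ _).trans (min_le_right _ _)))
  · exact hj₂ (s + 1) x (hx2.odd_season (k := 2 * n + 1) (by simp)
      (by rw [hs]; push_cast; ring)) (hb s x hx1 (h0.trans_le (min_le_right _ _))).1

/-- Sampling starts at time 1. A period then runs `-X₂` first and `-X₁` second, so its inverse runs
`X₁` and then `X₂`, and has the jet of the same composition as in `isRepeller_seasonal`. Sampling at
even times would give the composition in the other order. -/
theorem isLAS_seasonal_neg {l₁ b c d l₂ e : ℂ} (h₁ : ContDiff ℝ 1 X₁) (h₂ : ContDiff ℝ 1 X₂)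
    (h₁0 : X₁ 0 = 0) (h₂0 : X₂ 0 = 0) (hF₁ : TimeOneMapEq X₁ (cubicMap l₁ b c d) 4)
    (hF₂ : TimeOneMapEq X₂ (cubicMap l₂ 0 0 e) 4) (hV : IsComparable V)
    (hG : ChangesBy V (cubicMap (l₂ * l₁) (l₂ * b) (l₂ * c)
      (l₂ * d + e * (l₁ ^ 2 * (starRingEnd ℂ) l₁))) κ) (hκ : 0 < κ) :
    IsLAS (seasonal (fun z => -X₁ z) fun z => -X₂ z) 0 := by
  obtain ⟨K, hK, hgr⟩ := exists_hasLinearGrowth_seasonal h₁.neg h₂.neg (by simp [h₁0])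
    (by simp [h₂0])
  have hcut := hasGlobalCutoffs_seasonal h₁.neg h₂.neg
  obtain ⟨A₁, r₁, hr₁, hj₁⟩ := hF₁.backward h₁.continuous
  obtain ⟨A₂, r₂, hr₂, hj₂⟩ := hF₂.backward h₂.continuous
  obtain ⟨A, r, hr, hcomp⟩ := cubicMap_comp_jet l₁ b c d l₂ e A₁ A₂
  obtain ⟨M, σ, hM, hσ, hb⟩ := exists_norm_bounds_over_period hgr hK one_pos
    (show 0 < min r r₁ by positivity)
  obtain ⟨M', σ', hM', hσ', hb'⟩ := exists_norm_bounds_over_period hgr hK one_pos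
    (show 0 < min σ r₂ by positivity)
  refine isLAS_of_backwardJet hgr hK hcut zero_le_one two_pos hV hG hκ
    ⟨A, σ', hσ', fun n x hx h0 => ?_⟩
  set s : ℝ := 1 + 2 * n with hs
  have hs2 : s + 2 = s + 1 + 1 := by ring
  rw [hs2] at hx ⊢
  have hx1 := hx.mono (a' := s) (b' := s + 1) le_rfl (by linarith)
  have hx2 := hx.mono (a' := s + 1) (b' := s + 1 + 1) (by linarith) le_rfl
  have n1 := (hb' s x hx1 h0).1
  have n2 := (hb (s + 1) x hx2 (n1.trans_le (min_le_left _ _))).1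
  refine hcomp _ (x (s + 1)) _ (n2.trans_le (min_le_left _ _)) ?_ ?_
  · exact hj₁ (s + 1) x (hx2.even_season (k := 2 * n + 2) (by simp)
      (by rw [hs]; push_cast; ring)) (n2.trans_le (min_le_right _ _))
  · exact hj₂ s x (hx1.odd_season (k := 2 * n + 1) (by simp)
      (by rw [hs]; push_cast; ring)) (n1.trans_le (min_le_right _ _))

end Systems

/-! ### Jets of time-one maps -/

/-- The cubic vector field
`ω z + b z² + c z z̄ + d₃₀ z³ + d₂₁ z² z̄ + d₁₂ z z̄² + d₀₃ z̄³`. -/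
def cubicField (ω b c d₃₀ d₂₁ d₁₂ d₀₃ z : ℂ) : ℂ :=
  ω * z + b * z ^ 2 + c * (z * (starRingEnd ℂ) z) + d₃₀ * z ^ 3
    + d₂₁ * (z ^ 2 * (starRingEnd ℂ) z) + d₁₂ * (z * (starRingEnd ℂ) z ^ 2)
    + d₀₃ * (starRingEnd ℂ) z ^ 3

theorem contDiff_cubicField (ω b c d₃₀ d₂₁ d₁₂ d₀₃ : ℂ) :
    ContDiff ℝ 1 (cubicField ω b c d₃₀ d₂₁ d₁₂ d₀₃) := by
  have h : ContDiff ℝ 1 (fun z : ℂ => (starRingEnd ℂ) z) := Complex.conjCLE.contDiff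
  unfold cubicField
  fun_prop

theorem exists_solution_on_unit_interval {X : ℂ → ℂ} (hX : ContDiff ℝ 1 X) (hX0 : X 0 = 0) :
    ∃ r : ℝ, 0 < r ∧ ∀ z : ℂ, ‖z‖ < r →
      (∃ x : ℝ → ℂ, x 0 = z ∧ IsSolutionOn (autonomous X) 0 1 x) ∧
      ∀ x : ℝ → ℂ, x 0 = z → IsSolutionOn (autonomous X) 0 1 x →
        ∀ t ∈ Set.Icc (0 : ℝ) 1, ‖x t‖ ≤ 1 := by
  obtain ⟨K, hK, hgr⟩ := exists_hasLinearGrowth_seasonal hX hX hX0 hX0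
  have hcut := hasGlobalCutoffs_seasonal hX hX
  rw [seasonal_self] at hgr hcut
  set M := Real.exp ((K + 1) * 1) with hM
  have hM0 : 0 < M := Real.exp_pos _
  have hM1 : 1 ≤ M := Real.one_le_exp (by positivity)
  have grow : ∀ (T : ℝ) (x : ℝ → ℂ), T ≤ 1 → ‖x 0‖ < 1 / M →
      IsSolutionOn (autonomous X) 0 T x → ∀ t ∈ Set.Icc 0 T, ‖x t‖ < 1 := by
    intro T x hT h0 hx t ht
    rw [lt_div_iff₀ hM0] at h0
    have := hx.norm_le hgr hK (L := 1) (by linarith) h0 t ht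
    linarith
  refine ⟨1 / M, by positivity, fun z hz => ⟨?_, ?_⟩⟩
  · have hz1 : ‖z‖ < 1 := hz.trans_le (by rw [div_le_one hM0]; exact hM1)
    obtain ⟨x, hx0, hx | ⟨T, hT, hx, -, hxT⟩⟩ := hcut.exists_solution le_rfl hz1
    · exact ⟨x, hx0, hx.1 1⟩
    · rcases le_total T 1 with h | h
      · exact absurd hxT (grow T x h (by rwa [hx0]) hx T ⟨hT, le_rfl⟩).ne
      · exact ⟨x, hx0, hx.mono le_rfl h⟩
  · intro x hx0 hx t ht
    exact (grow 1 x le_rfl (by rwa [hx0]) hx t ht).le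

/-- If `u` is an approximate flow with residual `O(|z|⁴)`, then the time-one map is
`u 1 z + O(|z|⁴)`. -/
theorem timeOneMapEq_of_approx {X : ℂ → ℂ} (hX : ContDiff ℝ 1 X) (hX0 : X 0 = 0)
    {u u' : ℝ → ℂ → ℂ} (hu0 : ∀ z, u 0 z = z)
    (hu : ∀ t z, HasDerivAt (fun t => u t z) (u' t z) t)
    (hbd : (fun i : ℂ × ℝ => u i.2 i.1) =O[𝓝 0 ×ˢ 𝓟 (Set.Icc 0 1)] fun i => i.1)
    (hres : (fun i : ℂ × ℝ => u' i.2 i.1 - X (u i.2 i.1)) =O[𝓝 0 ×ˢ 𝓟 (Set.Icc 0 1)]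
      fun i => i.1 ^ 4) :
    TimeOneMapEq X (u 1) 4 := by
  obtain ⟨r₁, hr₁, hsol⟩ := exists_solution_on_unit_interval hX hX0
  obtain ⟨K, hK⟩ := exists_lipschitzOnWith_closedBall hX one_pos
  obtain ⟨B, hB0, hB⟩ := hbd.exists_pos
  obtain ⟨C, hC⟩ := hres.bound
  have hB := hB.bound
  rw [eventually_prod_principal_iff] at hB hC
  obtain ⟨r₂, hr₂, hB⟩ := Metric.eventually_nhds_iff.1 hB
  obtain ⟨r₃, hr₃, hC⟩ := Metric.eventually_nhds_iff.1 hC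
  -- With equal initial values, the Grönwall bound is linear in the residual `C * ‖z‖ ^ 4`.
  refine ⟨C * gronwallBound 0 K 1 1, min (min r₁ (1 / B)) (min r₂ r₃), by positivity,
    fun z hz => ?_⟩
  have z1 := hz.trans_le ((min_le_left _ _).trans (min_le_left _ _))
  have z2 := hz.trans_le ((min_le_left _ _).trans (min_le_right _ _))
  have z3 := hz.trans_le ((min_le_right _ _).trans (min_le_left _ _))
  have z4 := hz.trans_le ((min_le_right _ _).trans (min_le_right _ _))
  rw [lt_div_iff₀ hB0] at z2
  obtain ⟨hex, hall⟩ := hsol z z1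
  refine ⟨hex, fun x hx0 hx => ?_⟩
  have hxb := hall x hx0 hx
  have h := dist_le_of_approx_trajectories_ODE_of_mem (a := 0) (b := 1) (v := fun _ => X)
    (s := fun _ => Metric.closedBall 0 1) (K := K) (f := x) (f' := fun t => X (x t))
    (g := fun t => u t z) (g' := fun t => u' t z) (εf := 0) (εg := C * ‖z‖ ^ 4) (δ := 0)
    (fun _ _ => hK) hx.1 hx.2 (fun _ _ => by simp)
    (fun t ht => by simpa using hxb t ⟨ht.1, ht.2.le⟩)
    (fun t _ => (hu t z).continuousAt.continuousWithinAt)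
    (fun t _ => (hu t z).hasDerivWithinAt)
    (fun t ht => by
      have := hC (by simpa using z4) t ⟨ht.1, ht.2.le⟩
      simpa [dist_eq_norm] using this)
    (fun t ht => by
      have := hB (by simpa using z3) t ⟨ht.1, ht.2.le⟩
      simp only at this
      rw [mem_closedBall_zero_iff]
      linarith)
    (by simp [hx0, hu0]) 1 ⟨zero_le_one, le_rfl⟩
  rw [dist_eq_norm] at h
  refine h.trans_eq ?_
  simp only [gronwallBound]
  split_ifs <;> ring_nf

theorem isBigO_coeff {q : ℝ → ℂ} (hq : Continuous q) :
    (fun i : ℂ × ℝ => q i.2) =O[𝓝 0 ×ˢ 𝓟 (Set.Icc 0 1)] fun i => i.1 ^ 0 := by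
  obtain ⟨C, hC⟩ := isCompact_Icc.exists_bound_of_continuousOn (s := Set.Icc (0 : ℝ) 1)
    hq.continuousOn
  refine IsBigO.of_bound C ?_
  rw [eventually_prod_principal_iff]
  exact Eventually.of_forall fun z t ht => by simpa using hC t ht

/-- The time-one map of a cubic vector field, from the solutions of the equations for the
coefficients of the expansion `z(t) = e(t) (z + ⋯)` of its flow. -/
theorem timeOneMapEq_cubicField {ω b c d₃₀ d₂₁ d₁₂ d₀₃ : ℂ} {e e' q₂₀ q₁₁ k₃₀ k₂₁ k₁₂ k₀₃ : ℝ → ℂ}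
    (he : ∀ t, HasDerivAt e (ω * e t) t) (hee : ∀ t, e t * e' t = 1)
    (he' : ∀ t, (starRingEnd ℂ) (e t) = e' t)
    (hq₂₀ : ∀ t, HasDerivAt q₂₀ (b * e t) t) (hq₁₁ : ∀ t, HasDerivAt q₁₁ (c * e' t) t)
    (hk₃₀ : ∀ t, HasDerivAt k₃₀ (2 * b * e t * q₂₀ t + d₃₀ * e t ^ 2) t)
    (hk₂₁ : ∀ t, HasDerivAt k₂₁
      (2 * b * e t * q₁₁ t + c * e' t * ((starRingEnd ℂ) (q₁₁ t) + q₂₀ t) + d₂₁) t)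
    (hk₁₂ : ∀ t, HasDerivAt k₁₂
      (c * e' t * ((starRingEnd ℂ) (q₂₀ t) + q₁₁ t) + d₁₂ * e' t ^ 2) t)
    (hk₀₃ : ∀ t, HasDerivAt k₀₃ (d₀₃ * e' t ^ 4) t)
    (h0 : e 0 = 1 ∧ q₂₀ 0 = 0 ∧ q₁₁ 0 = 0 ∧ k₃₀ 0 = 0 ∧ k₂₁ 0 = 0 ∧ k₁₂ 0 = 0 ∧ k₀₃ 0 = 0) :
    TimeOneMapEq (cubicField ω b c d₃₀ d₂₁ d₁₂ d₀₃) (fun z => e 1 * (z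
      + (q₂₀ 1 * z ^ 2 + q₁₁ 1 * (z * (starRingEnd ℂ) z))
      + (k₃₀ 1 * z ^ 3 + k₂₁ 1 * (z ^ 2 * (starRingEnd ℂ) z)
        + k₁₂ 1 * (z * (starRingEnd ℂ) z ^ 2) + k₀₃ 1 * (starRingEnd ℂ) z ^ 3))) 4 := by
  set Q : ℝ → ℂ → ℂ := fun t z => q₂₀ t * z ^ 2 + q₁₁ t * (z * (starRingEnd ℂ) z) with hQ
  set k : ℝ → ℂ → ℂ := fun t z => k₃₀ t * z ^ 3 + k₂₁ t * (z ^ 2 * (starRingEnd ℂ) z)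
        + k₁₂ t * (z * (starRingEnd ℂ) z ^ 2) + k₀₃ t * (starRingEnd ℂ) z ^ 3 with hk
  set Q' : ℝ → ℂ → ℂ := fun t z => b * e t * z ^ 2 + c * e' t * (z * (starRingEnd ℂ) z) with hQ'
  set k' : ℝ → ℂ → ℂ := fun t z => (2 * b * e t * q₂₀ t + d₃₀ * e t ^ 2) * z ^ 3
    + (2 * b * e t * q₁₁ t + c * e' t * ((starRingEnd ℂ) (q₁₁ t) + q₂₀ t) + d₂₁)
      * (z ^ 2 * (starRingEnd ℂ) z)
    + (c * e' t * ((starRingEnd ℂ) (q₂₀ t) + q₁₁ t) + d₁₂ * e' t ^ 2)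
      * (z * (starRingEnd ℂ) z ^ 2)
    + d₀₃ * e' t ^ 4 * (starRingEnd ℂ) z ^ 3 with hk'
  have hQd : ∀ t z, HasDerivAt (fun t => Q t z) (Q' t z) t := fun t z =>
    ((hq₂₀ t).mul_const _).add ((hq₁₁ t).mul_const _)
  have hkd : ∀ t z, HasDerivAt (fun t => k t z) (k' t z) t := fun t z =>
    ((((hk₃₀ t).mul_const _).add ((hk₂₁ t).mul_const _)).add
      ((hk₁₂ t).mul_const _)).add ((hk₀₃ t).mul_const _)
  have cont : ∀ {q q' : ℝ → ℂ}, (∀ t, HasDerivAt q (q' t) t) → Continuous q := fun h =>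
    continuous_iff_continuousAt.2 fun t => (h t).continuousAt
  have hz1 : (fun i : ℂ × ℝ => i.1) =O[𝓝 0 ×ˢ 𝓟 (Set.Icc 0 1)] fun i => i.1 ^ 1 := by
    simpa using isBigO_refl (fun i : ℂ × ℝ => i.1) _
  have hz : Tendsto (fun i : ℂ × ℝ => i.1) (𝓝 0 ×ˢ 𝓟 (Set.Icc 0 1)) (𝓝 0) := tendsto_fst
  have hw1 := isBigO_conj hz1
  have hE := isBigO_coeff (cont he)
  have bu : (fun i : ℂ × ℝ => e i.2 * i.1) =O[𝓝 0 ×ˢ 𝓟 (Set.Icc 0 1)] fun i => i.1 ^ 1 :=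
    isBigO_pow_mul hE hz1 rfl
  have bQ : (fun i : ℂ × ℝ => e i.2 * Q i.2 i.1) =O[𝓝 0 ×ˢ 𝓟 (Set.Icc 0 1)]
      fun i => i.1 ^ 2 :=
    isBigO_pow_mul hE ((isBigO_pow_mul (isBigO_coeff (cont hq₂₀)) (isBigO_refl _ _)
      (zero_add 2)).add (isBigO_pow_mul (isBigO_coeff (cont hq₁₁))
      (isBigO_pow_mul hz1 hw1 rfl) rfl)) (zero_add 2)
  have hw2 : (fun i : ℂ × ℝ => (starRingEnd ℂ) i.1 ^ 2) =O[𝓝 0 ×ˢ 𝓟 (Set.Icc 0 1)]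
      fun i => i.1 ^ 2 := by simpa using hw1.pow 2
  have hw3 : (fun i : ℂ × ℝ => (starRingEnd ℂ) i.1 ^ 3) =O[𝓝 0 ×ˢ 𝓟 (Set.Icc 0 1)]
      fun i => i.1 ^ 3 := by simpa using hw1.pow 3
  have bk : (fun i : ℂ × ℝ => e i.2 * k i.2 i.1) =O[𝓝 0 ×ˢ 𝓟 (Set.Icc 0 1)]
      fun i => i.1 ^ 3 :=
    isBigO_pow_mul hE ((((isBigO_pow_mul (isBigO_coeff (cont hk₃₀)) (isBigO_refl _ _)
      (zero_add 3)).add (isBigO_pow_mul (isBigO_coeff (cont hk₂₁))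
      (isBigO_pow_mul (isBigO_refl _ _) hw1 rfl) rfl)).add
      (isBigO_pow_mul (isBigO_coeff (cont hk₁₂)) (isBigO_pow_mul hz1 hw2 rfl) rfl)).add
      (isBigO_pow_mul (isBigO_coeff (cont hk₀₃)) hw3 (zero_add 3))) (zero_add 3)
  set A : ℂ × ℝ → ℂ := fun i => e i.2 * Q i.2 i.1 + e i.2 * k i.2 i.1 with hA
  have bA : A =O[𝓝 0 ×ˢ 𝓟 (Set.Icc 0 1)] fun i => i.1 ^ 2 :=
    bQ.add (isBigO_pow_mono hz (by norm_num) bk)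
  set u : ℂ × ℝ → ℂ := fun i => e i.2 * i.1 + A i with hu
  have bw : u =O[𝓝 0 ×ˢ 𝓟 (Set.Icc 0 1)] fun i => i.1 ^ 1 :=
    bu.add (isBigO_pow_mono hz (by norm_num) bA)
  have bu' := isBigO_conj bu
  have bk' := isBigO_conj bk
  have bA' := isBigO_conj bA
  have bw' := isBigO_conj bw
  refine timeOneMapEq_of_approx (contDiff_cubicField ..) (by simp [cubicField])
    (u := fun t z => e t * (z + Q t z + k t z))
    (u' := fun t z => ω * e t * (z + Q t z + k t z) + e t * (Q' t z + k' t z)) ?_ ?_ ?_ ?_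
  · intro z
    obtain ⟨h1, h2, h3, h4, h5, h6, h7⟩ := h0
    simp [hQ, hk, h1, h2, h3, h4, h5, h6, h7]
  · intro t z
    exact (he t).mul (((hQd t z).const_add z).add (hkd t z))
  · refine (bw.congr_left fun i => ?_).trans (by simpa using hz1)
    simp only [hu, hA]
    ring
  -- `t1` to `t6` are the terms of order at least 4 left by each nonlinear monomial of the field,
  -- except `z̄³ z`-free lower orders, which cancel by the coefficient equations; `hee` is the only
  -- relation needed for that.
  · have t1 := (((isBigO_pow_mul bu bk rfl).const_mul_left 2).add
      (isBigO_pow_mul bA bA rfl)).const_mul_left b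
    have t2 := (((isBigO_pow_mul bu bk' rfl).add (isBigO_pow_mul bk bu' rfl)).add
      (isBigO_pow_mul bA bA' rfl)).const_mul_left c
    have t3 := (isBigO_pow_mul bA (((isBigO_pow_mul bw bw rfl).add
      (isBigO_pow_mul bw bu rfl)).add (isBigO_pow_mul bu bu rfl)) rfl).const_mul_left d₃₀
    have t4 := (((isBigO_pow_mul bA (isBigO_pow_mul bw bw' rfl) rfl).add
      (isBigO_pow_mul bA (isBigO_pow_mul bu bw' rfl) rfl)).add
      (isBigO_pow_mul (isBigO_pow_mul bu bu rfl) bA' rfl)).const_mul_left d₂₁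
    have t5 := (((isBigO_pow_mul bA' (isBigO_pow_mul bw' bw rfl) rfl).add
      (isBigO_pow_mul bA' (isBigO_pow_mul bu' bw rfl) rfl)).add
      (isBigO_pow_mul (isBigO_pow_mul bu' bu' rfl) bA rfl)).const_mul_left d₁₂
    have t6 := (isBigO_pow_mul bA' (((isBigO_pow_mul bw' bw' rfl).add
      (isBigO_pow_mul bw' bu' rfl)).add (isBigO_pow_mul bu' bu' rfl)) rfl).const_mul_left d₀₃
    refine (((((t1.add t2).add t3).add t4).add t5).add t6).neg_left.congr_left fun i => ?_
    have h1 := hee i.2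
    simp only [hu, hA, hQ, hk, hQ', hk', cubicField, map_add, map_mul, map_pow,
      Complex.conj_conj, he']
    generalize e i.2 = E at *
    generalize e' i.2 = E' at *
    generalize (starRingEnd ℂ) (q₂₀ i.2) = q₂₀'
    generalize (starRingEnd ℂ) (q₁₁ i.2) = q₁₁'
    generalize (starRingEnd ℂ) (k₃₀ i.2) = k₃₀'
    generalize (starRingEnd ℂ) (k₂₁ i.2) = k₂₁'
    generalize (starRingEnd ℂ) (k₁₂ i.2) = k₁₂'
    generalize (starRingEnd ℂ) (k₀₃ i.2) = k₀₃'
    generalize q₂₀ i.2 = q₂₀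
    generalize q₁₁ i.2 = q₁₁
    generalize k₃₀ i.2 = k₃₀
    generalize k₂₁ i.2 = k₂₁
    generalize k₁₂ i.2 = k₁₂
    generalize k₀₃ i.2 = k₀₃
    generalize (starRingEnd ℂ) i.1 = w
    generalize i.1 = z

    linear_combination (d₂₁ * E * z ^ 2 * w - d₀₃ * E' ^ 3 * w ^ 3) * h1

/-! ### Polynomial vector fields -/

theorem isPolynomialVF_const (c : ℂ) : IsPolynomialVF fun _ => c :=
  ⟨MvPolynomial.C c.re, MvPolynomial.C c.im, fun z => by simp⟩

theorem isPolynomialVF_id : IsPolynomialVF fun z => z :=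
  ⟨MvPolynomial.X 0, MvPolynomial.X 1, fun z => by simp⟩

theorem isPolynomialVF_conj : IsPolynomialVF fun z => (starRingEnd ℂ) z :=
  ⟨MvPolynomial.X 0, -MvPolynomial.X 1, fun z => by simp⟩

theorem IsPolynomialVF.add {X Y : ℂ → ℂ} (hX : IsPolynomialVF X) (hY : IsPolynomialVF Y) :
    IsPolynomialVF fun z => X z + Y z := by
  obtain ⟨P, Q, h⟩ := hX
  obtain ⟨P', Q', h'⟩ := hY
  exact ⟨P + P', Q + Q', fun z => by simp [h, h']⟩

theorem IsPolynomialVF.mul {X Y : ℂ → ℂ} (hX : IsPolynomialVF X) (hY : IsPolynomialVF Y) :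
    IsPolynomialVF fun z => X z * Y z := by
  obtain ⟨P, Q, h⟩ := hX
  obtain ⟨P', Q', h'⟩ := hY
  exact ⟨P * P' - Q * Q', P * Q' + Q * P', fun z => by simp [h, h']⟩

theorem IsPolynomialVF.pow {X : ℂ → ℂ} (hX : IsPolynomialVF X) (n : ℕ) :
    IsPolynomialVF fun z => X z ^ n := by
  induction n with
  | zero => simpa using isPolynomialVF_const 1
  | succ n ih => simpa only [pow_succ] using ih.mul hX

theorem isPolynomialVF_cubicField (ω b c d₃₀ d₂₁ d₁₂ d₀₃ : ℂ) :
    IsPolynomialVF (cubicField ω b c d₃₀ d₂₁ d₁₂ d₀₃) := by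
  have hz := isPolynomialVF_id
  have hw := isPolynomialVF_conj
  have hc := isPolynomialVF_const
  exact (((((((hc ω).mul hz).add ((hc b).mul (hz.pow 2))).add ((hc c).mul (hz.mul hw))).add
    ((hc d₃₀).mul (hz.pow 3))).add ((hc d₂₁).mul ((hz.pow 2).mul hw))).add
    ((hc d₁₂).mul (hz.mul (hw.pow 2)))).add ((hc d₀₃).mul (hw.pow 3))

theorem IsPolynomialVF.neg {X : ℂ → ℂ} (hX : IsPolynomialVF X) : IsPolynomialVF fun z => -X z := by
  simpa using (isPolynomialVF_const (-1)).mul hX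

/-! ### The example -/

theorem exX₁_eq (μ : ℂ) : exX₁ μ = cubicField (Complex.I * Real.pi / 2)
    (-(1 - Complex.I / 2) * Real.pi) ((1 / 4 - Complex.I / 4) * Real.pi)
    (-(3 - 4 * Complex.I) * Real.pi)
    (3 * Real.pi / 4 - 1 / 2 + Complex.I * (Real.pi / 2 - 11 / 2)) (3 * Real.pi / 4) μ := by
  funext z
  simp only [exX₁, cubicField]
  ring

theorem exX₂_eq : exX₂ = cubicField (Complex.I * Real.pi / 3) 0 0 0
    (-(1 / 2) + Complex.I * (Real.sqrt 3 : ℂ) / 2) 0 0 := by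
  funext z
  simp only [exX₂, cubicField]
  ring

theorem exF₁_eq : exF₁ = cubicMap Complex.I (1 - 3 * Complex.I) 1 0 := by
  funext z
  simp only [exF₁, cubicMap]
  ring

theorem exF₂_eq : exF₂ = cubicMap (1 / 2 * (1 + Complex.I * (Real.sqrt 3 : ℂ))) 0 0 (-1) := by
  funext z
  simp only [exF₂, cubicMap]
  ring

theorem hasDerivAt_cexp_mul (ω : ℂ) (t : ℝ) :
    HasDerivAt (fun t : ℝ => Complex.exp (ω * t)) (ω * Complex.exp (ω * t)) t := by
  have h := ((hasDerivAt_id t).ofReal_comp.const_mul ω).cexp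
  refine h.congr_deriv ?_
  simp
  ring

/-- The time-one map of a cubic vector field whose linear part is a rotation. -/
theorem timeOneMapEq_cubicField_rotation {ω : ℂ} (hωc : (starRingEnd ℂ) ω = -ω)
    (b c d₃₀ d₂₁ d₁₂ d₀₃ : ℂ) {e e' : ℂ} (he : Complex.exp ω = e) (he' : Complex.exp (-ω) = e') :
    TimeOneMapEq (cubicField ω (ω * b) (ω * c) (ω * d₃₀) d₂₁ (ω * d₁₂) (ω * d₀₃)) (fun z => e * (z
      + (b * (e - 1) * z ^ 2 + c * (1 - e') * (z * (starRingEnd ℂ) z))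
      + ((b ^ 2 * (e - 1) ^ 2 + d₃₀ / 2 * (e ^ 2 - 1)) * z ^ 3
        + (2 * b * c * (e - 1 - ω) + c * (b - (starRingEnd ℂ) c) * (ω - (1 - e')) + d₂₁)
          * (z ^ 2 * (starRingEnd ℂ) z)
        + (c * (c - (starRingEnd ℂ) b) / 2 * (1 - e') ^ 2 + d₁₂ / 2 * (1 - e' ^ 2))
          * (z * (starRingEnd ℂ) z ^ 2)
        + d₀₃ / 4 * (1 - e' ^ 4) * (starRingEnd ℂ) z ^ 3))) 4 := by
  set E : ℝ → ℂ := fun t => Complex.exp (ω * t) with hE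
  set E' : ℝ → ℂ := fun t => Complex.exp (-ω * t) with hE'
  have hconj : ∀ t : ℝ, (starRingEnd ℂ) (E t) = E' t := by
    intro t
    simp only [hE, hE']
    rw [← Complex.exp_conj]
    simp [hωc]
  have hconj' : ∀ t : ℝ, (starRingEnd ℂ) (E' t) = E t := fun t => by
    rw [← hconj, Complex.conj_conj]
  have hEE : ∀ t, E t * E' t = 1 := fun t => by
    simp only [hE, hE']
    rw [← Complex.exp_add]
    simp
  have dE : ∀ t, HasDerivAt E (ω * E t) t := hasDerivAt_cexp_mul ω
  have dE' : ∀ t, HasDerivAt E' (-ω * E' t) t := hasDerivAt_cexp_mul (-ω)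
  have dt : ∀ t : ℝ, HasDerivAt (fun t : ℝ => (t : ℂ)) 1 t := fun t =>
    (hasDerivAt_id t).ofReal_comp
  have h := timeOneMapEq_cubicField (ω := ω) (b := ω * b) (c := ω * c) (d₃₀ := ω * d₃₀)
    (d₂₁ := d₂₁) (d₁₂ := ω * d₁₂) (d₀₃ := ω * d₀₃) (e := E) (e' := E')
    (q₂₀ := fun t => b * (E t - 1)) (q₁₁ := fun t => c * (1 - E' t))
    (k₃₀ := fun t => b ^ 2 * (E t - 1) ^ 2 + d₃₀ / 2 * (E t ^ 2 - 1))
    -- The monomial `z² z̄` is resonant: in the rotating frame its forcing has a constant part, so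
    -- terms linear in `t` appear. This is why `d₂₁` carries no factor `ω`, whereas the factor in
    -- the other coefficients lets the exponentials integrate without a division.
    (k₂₁ := fun t => 2 * b * c * (E t - 1 - ω * t)
      + c * (b - (starRingEnd ℂ) c) * (ω * t - (1 - E' t)) + d₂₁ * t)
    (k₁₂ := fun t => c * (c - (starRingEnd ℂ) b) / 2 * (1 - E' t) ^ 2
      + d₁₂ / 2 * (1 - E' t ^ 2))
    (k₀₃ := fun t => d₀₃ / 4 * (1 - E' t ^ 4))
    dE hEE hconj
    (fun t => (((dE t).sub_const 1).const_mul _).congr_deriv (by ring))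
    (fun t => (((dE' t).const_sub 1).const_mul _).congr_deriv (by ring))
    (fun t => (((((dE t).sub_const 1).pow 2).const_mul _).add
      ((((dE t).pow 2).sub_const 1).const_mul _)).congr_deriv (by
        push_cast; ring))
    (fun t => ((((((dE t).sub_const 1).sub ((dt t).const_mul ω)).const_mul _).add
      ((((dt t).const_mul ω).sub ((dE' t).const_sub 1)).const_mul _)).add
      ((dt t).const_mul d₂₁)).congr_deriv (by
        simp only [map_mul, map_sub, map_one, hconj']
        linear_combination (2 * b * c - c * (b - (starRingEnd ℂ) c)) * ω * hEE t))
    (fun t => (((((dE' t).const_sub 1).pow 2).const_mul _).add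
      ((((dE' t).pow 2).const_sub 1).const_mul _)).congr_deriv (by
        simp only [map_mul, map_sub, map_one, hconj]
        push_cast
        ring))
    (fun t => ((((dE' t).pow 4).const_sub 1).const_mul _).congr_deriv (by
        push_cast; ring))
    (by simp [hE, hE'])
  have hE1 : E 1 = e := by simp [hE, he]
  have hE1' : E' 1 = e' := by simp [hE', he']
  simpa only [hE1, hE1', Complex.ofReal_one, mul_one] using h

theorem ofReal_sqrt_three_sq : (Real.sqrt 3 : ℂ) ^ 2 = 3 := by
  rw [← Complex.ofReal_pow, Real.sq_sqrt (by norm_num)]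
  norm_num

theorem timeOneMapEq_exX₂ : TimeOneMapEq exX₂ exF₂ 4 := by
  have he : Complex.exp (Complex.I * Real.pi / 3) = 1 / 2 + (Real.sqrt 3 : ℂ) / 2 * Complex.I := by
    rw [show Complex.I * Real.pi / 3 = ((Real.pi / 3 : ℝ) : ℂ) * Complex.I by
      push_cast; ring, Complex.exp_mul_I, ← Complex.ofReal_cos, ← Complex.ofReal_sin,
      Real.cos_pi_div_three, Real.sin_pi_div_three]
    push_cast
    ring
  have h := timeOneMapEq_cubicField_rotation (ω := Complex.I * Real.pi / 3)
    (Complex.ext (by simp [-map_div₀]) (by simp [-map_div₀])) 0 0 0 (-(1 / 2) + Complex.I * (Real.sqrt 3 : ℂ) / 2) 0 0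
    he rfl
  rw [exX₂_eq]
  simp only [mul_zero] at h
  convert h using 1
  funext z
  simp only [exF₂]
  linear_combination (-1 / 4 * z ^ 2 * (starRingEnd ℂ) z * Complex.I ^ 2) * ofReal_sqrt_three_sq
    - 3 / 4 * z ^ 2 * (starRingEnd ℂ) z * Complex.I_sq

theorem timeOneMapEq_exX₁ (μ : ℂ) : TimeOneMapEq (exX₁ μ) exF₁ 4 := by
  have he : Complex.exp (Complex.I * Real.pi / 2) = Complex.I := by
    rw [show Complex.I * Real.pi / 2 = (Real.pi : ℂ) / 2 * Complex.I by ring]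
    exact Complex.exp_pi_div_two_mul_I
  have he' : Complex.exp (-(Complex.I * Real.pi / 2)) = -Complex.I := by
    rw [Complex.exp_neg, he, Complex.inv_I]
  have hπ : (Real.pi : ℂ) ≠ 0 := by simp [Real.pi_ne_zero]
  have hb : (starRingEnd ℂ) (1 + 2 * Complex.I) = 1 - 2 * Complex.I :=
    Complex.ext (by simp) (by simp)
  have hc : (starRingEnd ℂ) (-(1 + Complex.I) / 2) = -(1 - Complex.I) / 2 :=
    Complex.ext (by simp [-map_div₀]) (by simp [-map_div₀]; norm_num)
  -- The cubic coefficients are those for which `z³`, `z² z̄` and `z z̄²` disappear from the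
  -- time-one map. The parameter `μ` is free because the coefficient of `z̄³` has the factor `1 - e'
  -- ^ 4`, which vanishes at `e' = -i`.
  have h := timeOneMapEq_cubicField_rotation (ω := Complex.I * Real.pi / 2)
    (Complex.ext (by simp [-map_div₀]) (by simp [-map_div₀])) (1 + 2 * Complex.I) (-(1 + Complex.I) / 2)
    (8 + 6 * Complex.I) (3 * Real.pi / 4 - 1 / 2 + Complex.I * (Real.pi / 2 - 11 / 2))
    (-3 * Complex.I / 2) (-2 * Complex.I * μ / Real.pi) he he'
  have hi : Complex.I ^ 2 = -1 := Complex.I_sq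
  rw [exX₁_eq]
  convert h using 1
  · congr 1
    · linear_combination (-Real.pi : ℂ) * hi
    · linear_combination (Real.pi / 4 : ℂ) * hi
    · linear_combination (-3 * Real.pi : ℂ) * hi
    · linear_combination (3 * Real.pi / 4 : ℂ) * hi
    · field_simp
      linear_combination μ * hi
  · funext z
    simp only [exF₁, hb, hc]
    generalize (starRingEnd ℂ) z = w
    generalize -2 * Complex.I * μ / Real.pi = m
    generalize (Real.pi : ℂ) = p
    generalize Complex.I = i at hi ⊢
    clear he he' hb hc hπ h
    grind

/-! ### Stability of fixed points and the values of `κ` for the three maps -/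

theorem cubicMap_zero (l b c d : ℂ) : cubicMap l b c d 0 = 0 := by simp [cubicMap]

theorem norm_cubicMap_le (l b c d : ℂ) {z : ℂ} (hz : ‖z‖ ≤ 1) :
    ‖cubicMap l b c d z‖ ≤ (‖l‖ + ‖b‖ + ‖c‖ + ‖d‖) * ‖z‖ := by
  have h2 : ‖z‖ ^ 2 ≤ ‖z‖ := pow_le_of_le_one (norm_nonneg _) hz two_ne_zero
  have h3 : ‖z‖ ^ 3 ≤ ‖z‖ := pow_le_of_le_one (norm_nonneg _) hz three_ne_zero
  calc ‖cubicMap l b c d z‖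
      ≤ ‖l‖ * ‖z‖ + ‖b‖ * ‖z‖ ^ 2 + ‖c‖ * ‖z‖ ^ 2 + ‖d‖ * ‖z‖ ^ 3 := by
        refine (norm_add₄_le ..).trans_eq ?_
        simp only [norm_mul, norm_pow, RCLike.norm_conj]
        ring
    _ ≤ ‖l‖ * ‖z‖ + ‖b‖ * ‖z‖ + ‖c‖ * ‖z‖ + ‖d‖ * ‖z‖ := by gcongr
    _ = _ := by ring

theorem isLASFixedPoint_cubicMap {l b c d : ℂ} {V : ℂ → ℝ} {κ : ℝ} (hV : IsComparable V)
    (hG : ChangesBy V (cubicMap l b c d) κ) (hκ : κ < 0) :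
    IsLASFixedPoint (cubicMap l b c d) 0 := by
  obtain ⟨r, hr, hG⟩ := hG 0
  refine isLASFixedPoint_of_step_decrease (cubicMap_zero ..) hV (ρ := min r 1) (c := -κ / 2)
    (by positivity) (by linarith)
    (fun z hz => norm_cubicMap_le l b c d (hz.trans_le (min_le_right _ _)).le) fun z hz => ?_
  have h := hG z (cubicMap l b c d z) (hz.trans_le (min_le_left _ _)) (by simp)
  rw [abs_of_neg hκ] at h
  linarith [(abs_le.1 h).2]

theorem isRepellerFixedPoint_comp_cubicMap {l₁ b c d l₂ e : ℂ} {V : ℂ → ℝ} {κ : ℝ}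
    (hV : IsComparable V) (hG : ChangesBy V (cubicMap (l₂ * l₁) (l₂ * b) (l₂ * c)
      (l₂ * d + e * (l₁ ^ 2 * (starRingEnd ℂ) l₁))) κ) (hκ : 0 < κ) :
    IsRepellerFixedPoint (fun z => cubicMap l₂ 0 0 e (cubicMap l₁ b c d z)) 0 := by
  obtain ⟨A, r₁, hr₁, hcomp⟩ := cubicMap_comp_jet l₁ b c d l₂ e 0 0
  obtain ⟨r, hr, hG⟩ := hG A
  refine isRepellerFixedPoint_of_step_increase (by simp [cubicMap_zero]) hV (ρ := min r r₁)
    (c := κ / 2) (by positivity) (by linarith) fun z hz => ?_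
  have h := hG z _ (hz.trans_le (min_le_left _ _))
    (hcomp z (cubicMap l₁ b c d z) (cubicMap l₂ 0 0 e (cubicMap l₁ b c d z))
      (hz.trans_le (min_le_right _ _)) (by simp) (by simp))
  rw [abs_of_pos hκ] at h
  linarith [(abs_le.1 h).1]

theorem exists_changesBy_exF₁ : ∃ V, IsComparable V ∧ ChangesBy V exF₁ (-1) := by
  rw [exF₁_eq]
  have hi : Complex.I ^ 2 = -1 := Complex.I_sq
  have hb : (starRingEnd ℂ) (1 - 3 * Complex.I) = 1 + 3 * Complex.I :=
    Complex.ext (by simp) (by simp)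
  have hβ : (starRingEnd ℂ) (-3 / 2 * (1 + Complex.I)) = -3 / 2 * (1 - Complex.I) :=
    Complex.ext (by simp [-map_div₀]) (by simp [-map_div₀])
  -- The value `β = 3/(i - 1)` solves the homological equation. Then `|b|² + |c|² = 11` and the two
  -- `β` terms add up to `-12`, so `κ = -1`.
  refine exists_changesBy_cubicMap (β := -3 / 2 * (1 + Complex.I)) (by norm_num) ?_ ?_ ?_ ?_
  · rw [Complex.conj_I]
    linear_combination -hi
  · rw [hi]
    norm_num
  · rw [Complex.conj_I, map_one]
    linear_combination (3 / 2 : ℂ) * hi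
  · rw [Complex.conj_I, map_one, map_zero, hb, hβ]
    push_cast
    generalize Complex.I = i at *
    clear hb hβ
    grind

theorem conj_exF₂_multiplier :
    (starRingEnd ℂ) (1 / 2 * (1 + Complex.I * (Real.sqrt 3 : ℂ)))
      = 1 / 2 * (1 - Complex.I * (Real.sqrt 3 : ℂ)) :=
  Complex.ext (by simp [-map_div₀]) (by simp [-map_div₀])

theorem exists_changesBy_exF₂ : ∃ V, IsComparable V ∧ ChangesBy V exF₂ (-1) := by
  rw [exF₂_eq]
  have hi : Complex.I ^ 2 = -1 := Complex.I_sq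
  have hs := ofReal_sqrt_three_sq
  refine exists_changesBy_cubicMap (β := 0) (by norm_num) ?_ ?_ ?_ ?_
  · rw [conj_exF₂_multiplier]
    generalize (Real.sqrt 3 : ℂ) = s at *
    generalize Complex.I = i at *
    grind
  · intro h
    generalize (Real.sqrt 3 : ℂ) = s at *
    generalize Complex.I = i at *
    grind
  · simp
  · simp only [conj_exF₂_multiplier, map_neg, map_one, map_zero]
    push_cast
    ring

/-- The multiplier is `exp(5πi/6)`. The moduli of `b` and `c` are those of `F₁` and still give 11,
and the cubic term gives `-1`; the new divisor changes the `β` contribution from `-12` to `3√3 -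
15`. -/
theorem exists_changesBy_comp : ∃ V, IsComparable V ∧
    ChangesBy V (cubicMap (1 / 2 * (1 + Complex.I * (Real.sqrt 3 : ℂ)) * Complex.I)
      (1 / 2 * (1 + Complex.I * (Real.sqrt 3 : ℂ)) * (1 - 3 * Complex.I))
      (1 / 2 * (1 + Complex.I * (Real.sqrt 3 : ℂ)) * 1)
      (1 / 2 * (1 + Complex.I * (Real.sqrt 3 : ℂ)) * 0
        + -1 * (Complex.I ^ 2 * (starRingEnd ℂ) Complex.I))) (3 * Real.sqrt 3 - 5) := by
  have hi : Complex.I ^ 2 = -1 := Complex.I_sq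
  have hs := ofReal_sqrt_three_sq
  have hb : (starRingEnd ℂ) (1 - 3 * Complex.I) = 1 + 3 * Complex.I :=
    Complex.ext (by simp) (by simp)
  have hβ : (starRingEnd ℂ) (-3 / 2 - (3 - 3 / 2 * (Real.sqrt 3 : ℂ)) * Complex.I)
      = -3 / 2 + (3 - 3 / 2 * (Real.sqrt 3 : ℂ)) * Complex.I :=
    Complex.ext (by simp [-map_div₀]) (by simp [-map_div₀])
  refine exists_changesBy_cubicMap
    (β := -3 / 2 - (3 - 3 / 2 * (Real.sqrt 3 : ℂ)) * Complex.I) ?_ ?_ ?_ ?_ ?_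
  · intro h
    have h1 : Real.sqrt 3 = 5 / 3 := by linarith
    have h2 := Real.sq_sqrt (show (0 : ℝ) ≤ 3 by norm_num)
    rw [h1] at h2
    norm_num at h2
  · simp only [map_mul (starRingEnd ℂ) _ Complex.I, conj_exF₂_multiplier, Complex.conj_I]
    generalize (Real.sqrt 3 : ℂ) = s at *
    generalize Complex.I = i at *
    grind
  · intro h
    generalize (Real.sqrt 3 : ℂ) = s at *
    generalize Complex.I = i at *
    grind
  · rw [mul_one, map_mul (starRingEnd ℂ) _ Complex.I, conj_exF₂_multiplier, Complex.conj_I]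
    clear hb hβ
    generalize (Real.sqrt 3 : ℂ) = s at *
    generalize Complex.I = i at *
    grind
  · rw [mul_one, mul_zero, zero_add, hβ, map_mul (starRingEnd ℂ) _ Complex.I,
      map_mul (starRingEnd ℂ) _ (1 - 3 * Complex.I), conj_exF₂_multiplier, hb, hi]
    simp only [map_mul, map_neg, map_one, Complex.conj_I]
    push_cast
    clear hb hβ
    generalize (Real.sqrt 3 : ℂ) = s at *
    generalize Complex.I = i at *
    grind

theorem three_mul_sqrt_three_sub_five_pos : 0 < 3 * Real.sqrt 3 - 5 := by
  have : (5 / 3 : ℝ) < Real.sqrt 3 := Real.lt_sqrt_of_sq_lt (by norm_num)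
  linarith

theorem reversesLAS_ex (μ : ℂ) : ReversesLAS (exX₁ μ) exX₂ 0 := by
  obtain ⟨V₁, hV₁, hG₁⟩ := exists_changesBy_exF₁
  obtain ⟨V₂, hV₂, hG₂⟩ := exists_changesBy_exF₂
  obtain ⟨V, hV, hG⟩ := exists_changesBy_comp
  have hF₁ := timeOneMapEq_exX₁ μ
  have hF₂ := timeOneMapEq_exX₂
  have h₁0 : exX₁ μ 0 = 0 := by simp [exX₁_eq, cubicField]
  have h₂0 : exX₂ 0 = 0 := by simp [exX₂_eq, cubicField]
  have hd₁ : ContDiff ℝ 1 (exX₁ μ) := exX₁_eq μ ▸ contDiff_cubicField ..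
  have hd₂ : ContDiff ℝ 1 exX₂ := exX₂_eq ▸ contDiff_cubicField ..
  refine ⟨exX₁_eq μ ▸ isPolynomialVF_cubicField .., exX₂_eq ▸ isPolynomialVF_cubicField ..,
    h₁0, h₂0, isLAS_autonomous hd₁ h₁0 hF₁ hV₁ hG₁ (by norm_num),
    isLAS_autonomous hd₂ h₂0 hF₂ hV₂ hG₂ (by norm_num), ?_⟩
  rw [exF₁_eq] at hF₁
  rw [exF₂_eq] at hF₂
  exact isRepeller_seasonal hd₁ hd₂ h₁0 h₂0 hF₁ hF₂ hV hG three_mul_sqrt_three_sub_five_pos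

theorem reversesRepeller_ex (μ : ℂ) :
    ReversesRepeller (fun z => -exX₁ μ z) (fun z => -exX₂ z) 0 := by
  obtain ⟨V₁, hV₁, hG₁⟩ := exists_changesBy_exF₁
  obtain ⟨V₂, hV₂, hG₂⟩ := exists_changesBy_exF₂
  obtain ⟨V, hV, hG⟩ := exists_changesBy_comp
  have hF₁ := timeOneMapEq_exX₁ μ
  have hF₂ := timeOneMapEq_exX₂
  obtain ⟨hP₁, hP₂, h₁0, h₂0, -⟩ := reversesLAS_ex μ
  have hd₁ : ContDiff ℝ 1 (exX₁ μ) := exX₁_eq μ ▸ contDiff_cubicField ..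
  have hd₂ : ContDiff ℝ 1 exX₂ := exX₂_eq ▸ contDiff_cubicField ..
  refine ⟨hP₁.neg, hP₂.neg, by simp [h₁0], by simp [h₂0],
    isRepeller_autonomous_neg hd₁ h₁0 hF₁ hV₁ hG₁ (by norm_num),
    isRepeller_autonomous_neg hd₂ h₂0 hF₂ hV₂ hG₂ (by norm_num), ?_⟩
  rw [exF₁_eq] at hF₁
  rw [exF₂_eq] at hF₂
  exact isLAS_seasonal_neg hd₁ hd₂ h₁0 h₂0 hF₁ hF₂ hV hG three_mul_sqrt_three_sub_five_pos

theorem isLASFixedPoint_exF₁ : IsLASFixedPoint exF₁ 0 := by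
  obtain ⟨V, hV, hG⟩ := exists_changesBy_exF₁
  rw [exF₁_eq] at hG ⊢
  exact isLASFixedPoint_cubicMap hV hG (by norm_num)

theorem isLASFixedPoint_exF₂ : IsLASFixedPoint exF₂ 0 := by
  obtain ⟨V, hV, hG⟩ := exists_changesBy_exF₂
  rw [exF₂_eq] at hG ⊢
  exact isLASFixedPoint_cubicMap hV hG (by norm_num)

theorem isRepellerFixedPoint_comp : IsRepellerFixedPoint (fun z => exF₂ (exF₁ z)) 0 := by
  obtain ⟨V, hV, hG⟩ := exists_changesBy_comp
  rw [exF₁_eq, exF₂_eq]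
  exact isRepellerFixedPoint_comp_cubicMap hV hG three_mul_sqrt_three_sub_five_pos

end Seasonal

end

theorem theoremt :
    (∃ (X₁ X₂ : ℂ → ℂ) (p : ℂ), Seasonal.ReversesLAS X₁ X₂ p) ∧
    (∃ (X₁ X₂ : ℂ → ℂ) (p : ℂ), Seasonal.ReversesRepeller X₁ X₂ p) ∧
    (∀ μ : ℂ,
      Seasonal.ReversesLAS (Seasonal.exX₁ μ) Seasonal.exX₂ 0 ∧
      Seasonal.ReversesRepeller (fun z => -Seasonal.exX₁ μ z) (fun z => -Seasonal.exX₂ z) 0 ∧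
      Seasonal.TimeOneMapEq (Seasonal.exX₁ μ) Seasonal.exF₁ 4) ∧
    Seasonal.TimeOneMapEq Seasonal.exX₂ Seasonal.exF₂ 4 ∧
    Seasonal.IsLASFixedPoint Seasonal.exF₁ 0 ∧
    Seasonal.IsLASFixedPoint Seasonal.exF₂ 0 ∧
    Seasonal.IsRepellerFixedPoint (fun z => Seasonal.exF₂ (Seasonal.exF₁ z)) 0 := by
  refine ⟨⟨_, _, _, Seasonal.reversesLAS_ex 0⟩, ⟨_, _, _, Seasonal.reversesRepeller_ex 0⟩,
    fun μ => ⟨Seasonal.reversesLAS_ex μ, Seasonal.reversesRepeller_ex μ,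
      Seasonal.timeOneMapEq_exX₁ μ⟩, Seasonal.timeOneMapEq_exX₂, Seasonal.isLASFixedPoint_exF₁,
    Seasonal.isLASFixedPoint_exF₂, Seasonal.isRepellerFixedPoint_comp⟩
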